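/- Let $\mathbb S^3=\{(z_1,z_2)\in\mathbb C^2:|z_1|^2+|z_2|^2=1\}$ carry its round metric, with volume measure $\mathrm{dVol}$ and one-dimensional Hausdorff measure $\mathscr H^1$, and let $$H_0=\{(z_1,0):|z_1|=1\},\qquad H_1=\{(0,z_2):|z_2|=1\}$$ be the two components of the standard Hopf link. A \emph{curve} is a subset of $\mathbb S^3$ with more than one point which is a continuous image of $[0,1]$. Two curves $C_0,C_1\subset\mathbb S^3$ are \emph{linked} if $C_0$ is not null-homotopic in $\mathbb S^3\setminus C_1$ and $C_1$ is not null-homotopic in $\mathbb S^3\setminus C_0$; here a set $A$ is null-homotopic in $U$ if $A\subset U$ and the inclusion $A\hookrightarrow U$ is homotopic to a constant map. Let $\Delta(C_0,C_1)$ be the family of all continuous paths $\gamma\colon[0,1]\to\mathbb S^3$ with $\gamma(0)\in C_0$ and $\gamma(1)\in C_1$. For a family $\Gamma$ of paths, put $$\mathrm{Mod}_3(\Gamma)=\inf_\rho\int_{\mathbb S^3}\rho^3\,\mathrm{dVol}\in[0,\infty],$$ where the infimum is over all Borel functions $\rho\colon\mathbb S^3\to[0,\infty]$ with $\int_{\gamma([0,1])}\rho\,\mathrm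 d\mathscr H^1\ge 1$ for all $\gamma\in\Gamma$ (and is $\infty$ if there is no such $\rho$). \textbf{Proposition.} Let $C_0,C_1\subset\mathbb S^3$ be linked curves such that $C_0$ is a round circle. Then $$\mathrm{Mod}_3(\Delta(H_0,H_1))\le \mathrm{Mod}_3(\Delta(C_0,C_1)).$$ -/

import Mathlib

open MeasureTheory Set
open scoped ENNReal unitInterval

/-- The unit sphere `𝕊³ ⊆ ℝ⁴ = ℂ²`, a point `x` standing for
`(z₁, z₂) = (x 0 + i x 1, x 2 + i x 3)`. -/
abbrev S3 : Type := Metric.sphere (0 : EuclideanSpace ℝ (Fin 4)) 1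

/-- The Riemannian volume measure of the round sphere `𝕊³` (the surface measure, of total
mass `2π²`). -/
noncomputable def volS3 : Measure S3 :=
  (volume : Measure (EuclideanSpace ℝ (Fin 4))).toSphere

/-- A curve: a continuous image of the unit interval that contains more than one point. -/
def IsCurve (C : Set S3) : Prop :=
  C.Nontrivial ∧ ∃ γ : C(I, S3), range γ = C

/-- A (round) circle contained in `𝕊³`. -/
def IsCircle (C : Set S3) : Prop :=
  ∃ (c u v : EuclideanSpace ℝ (Fin 4)) (r : ℝ), 0 < r ∧ Orthonormal ℝ ![u, v] ∧
    ((↑) '' C : Set (EuclideanSpace ℝ (Fin 4))) =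
      range fun t : ℝ => c + r • (Real.cos t • u + Real.sin t • v)

/-- `A` is null-homotopic in `U`: it is contained in `U`, and the inclusion `A → U` is
homotopic to a constant map. -/
def NullhomotopicIn (A U : Set S3) : Prop :=
  ∃ h : A ⊆ U, (⟨inclusion h, continuous_inclusion h⟩ : C(A, U)).Nullhomotopic

/-- Neither of the two sets is null-homotopic in the complement of the other. -/
def Linked (C₀ C₁ : Set S3) : Prop :=
  ¬ NullhomotopicIn C₀ C₁ᶜ ∧ ¬ NullhomotopicIn C₁ C₀ᶜ

/-- Borel densities `ρ : 𝕊³ → [0, ∞]` with `∫_γ ρ dℋ¹ ≥ 1` for every path `γ` of the family. -/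
def Admissible (Γ : Set C(I, S3)) : Set (S3 → ℝ≥0∞) :=
  {ρ | Measurable ρ ∧ ∀ γ ∈ Γ, 1 ≤ ∫⁻ x in range γ, ρ x ∂μH[1]}

/-- The path `p`-modulus of a family of paths in `𝕊³`. -/
noncomputable def pathModulus (p : ℝ) (Γ : Set C(I, S3)) : ℝ≥0∞ :=
  ⨅ ρ ∈ Admissible Γ, ∫⁻ x, ρ x ^ p ∂volS3

/-- The family `Δ(C₀, C₁)` of paths that connect `C₀` and `C₁`. -/
def connectingPaths (C₀ C₁ : Set S3) : Set C(I, S3) :=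
  {γ | γ 0 ∈ C₀ ∧ γ 1 ∈ C₁}

/-- The component `{(z₁, 0) : |z₁| = 1}` of the Hopf link. -/
def hopf₀ : Set S3 := {x | x.1 2 = 0 ∧ x.1 3 = 0}

/-- The component `{(0, z₂) : |z₂| = 1}` of the Hopf link. -/
def hopf₁ : Set S3 := {x | x.1 0 = 0 ∧ x.1 1 = 0}

/-! Both moduli are compared with the number `(2π)² / L²`, where `L = extremalLength` is the
integral of `w ^ (-1/2)` over `(0, 1)` and `w t = t (1 - t²) / 2`.

Lower bound (`lower_bound_pathModulus`). Stereographic projection from a point of the circle `C₀`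
turns it into a line. Every open half-plane bounded by this line meets `C₁`, since otherwise `C₁`
could be contracted in the complement of `C₀` to a point on the opposite side. In each half-plane
choose such a point and take hyperbolic polar coordinates around it. The geodesic rays run from `C₁`
to `C₀`, so an admissible `ρ` has integral at least `1` along each of them. The exponent `3` is the
dimension, so the conformal factors cancel from `∫ ρ³`. The Euclidean height `y`, which is the
Jacobian of the rotation about the line, combines with the hyperbolic coordinates to the weight `w`,
whatever the chosen point. Hölder's inequality on each ray gives `1 / L²`, and integration over the
directions and the half-planes gives `(2π)² / L²`.

Upper bound (`pathModulus_hopf_le`). For the Hopf link the line is `H₀` and the chosen points form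
the circle `H₁`. The density for which Hölder is an equality on every ray depends only on the
distance to `H₁`; it is admissible for all connecting paths because each of them passes through all
these distances. -/

/-! ### Hausdorff measure under maps with a conformal distortion bound -/

open Filter Topology in
/-- A map with `dist (f x) (f y) ≤ h x * h y * dist x y` increases one-dimensional Hausdorff
measure at most by the density `h ^ 2`. -/
theorem hausdorffMeasure_image_le_lintegral_sq {X Y : Type*} [MetricSpace X] [MeasurableSpace X]
    [BorelSpace X] [MetricSpace Y] [MeasurableSpace Y] [BorelSpace Y] {f : X → Y} {h : X → ℝ}
    {A : Set X} (hA : MeasurableSet A) (hh : Measurable h) (hpos : ∀ x ∈ A, 0 < h x)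
    (hf : ∀ x ∈ A, ∀ y ∈ A, dist (f x) (f y) ≤ h x * h y * dist x y) :
    μH[1] (f '' A) ≤ ∫⁻ x in A, ENNReal.ofReal (h x ^ 2) ∂μH[1] := by
  have key : ∀ c : ℝ, 1 < c →
      μH[1] (f '' A) ≤ ENNReal.ofReal (c ^ 2) * ∫⁻ x in A, ENNReal.ofReal (h x ^ 2) ∂μH[1] := by
    intro c hc
    have hc0 : 0 < c := by linarith
    -- On such a shell `f` is Lipschitz with constant `(c ^ (n + 1)) ^ 2`, at most `c ^ 2` times the
    -- density `h ^ 2`. The loss `c ^ 2` disappears as `c → 1`.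
    let B : ℤ → Set X := fun n => A ∩ h ⁻¹' Ico (c ^ n) (c ^ (n + 1))
    have hBm : ∀ n, MeasurableSet (B n) := fun n => hA.inter (hh measurableSet_Ico)
    have hBu : A = ⋃ n, B n := by
      ext x
      simp only [B, mem_iUnion, mem_inter_iff, mem_preimage]
      refine ⟨fun hx => ?_, fun ⟨_, hx, _⟩ => hx⟩
      obtain ⟨n, hn⟩ := exists_mem_Ico_zpow (hpos x hx) hc
      exact ⟨n, hx, hn⟩
    have hBd : Pairwise (Function.onFun Disjoint B) := by
      intro m n hmn
      refine Set.disjoint_left.2 fun x hm hn => hmn ?_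
      have h1 := (zpow_lt_zpow_iff_right₀ hc).1 (hm.2.1.trans_lt hn.2.2)
      have h2 := (zpow_lt_zpow_iff_right₀ hc).1 (hn.2.1.trans_lt hm.2.2)
      omega
    have hB : ∀ n, μH[1] (f '' B n) ≤
        ENNReal.ofReal (c ^ 2) * ∫⁻ x in B n, ENNReal.ofReal (h x ^ 2) ∂μH[1] := by
      intro n
      have hcn : 0 < c ^ n := zpow_pos hc0 n
      have hlip : LipschitzOnWith (Real.toNNReal ((c ^ (n + 1)) ^ 2)) f (B n) := by
        refine LipschitzOnWith.of_dist_le_mul fun x hx y hy => ?_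
        rw [Real.coe_toNNReal _ (by positivity)]
        refine (hf x hx.1 y hy.1).trans ?_
        have := mul_le_mul hx.2.2.le hy.2.2.le (hpos y hy.1).le (by positivity)
        rw [sq]
        gcongr
      have h1 := hlip.hausdorffMeasure_image_le (d := 1) zero_le_one
      rw [ENNReal.rpow_one] at h1
      refine h1.trans ?_
      have h2 : ∫⁻ _ in B n, ENNReal.ofReal ((c ^ n) ^ 2) ∂(μH[1] : Measure X) ≤
          ∫⁻ x in B n, ENNReal.ofReal (h x ^ 2) ∂μH[1] := by
        refine setLIntegral_mono' (hBm n) fun x hx => ?_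
        have := hx.2.1
        gcongr
      rw [setLIntegral_const] at h2
      refine le_trans (le_of_eq ?_) (mul_le_mul_right h2 (ENNReal.ofReal (c ^ 2)))
      rw [← mul_assoc, ← ENNReal.ofReal_mul (by positivity)]
      congr 1
      change ENNReal.ofReal _ = _
      rw [zpow_add_one₀ hc0.ne']
      ring_nf
    calc μH[1] (f '' A) = μH[1] (⋃ n, f '' B n) := by rw [← image_iUnion, ← hBu]
      _ ≤ ∑' n, μH[1] (f '' B n) := measure_iUnion_le _
      _ ≤ ∑' n, ENNReal.ofReal (c ^ 2) * ∫⁻ x in B n, ENNReal.ofReal (h x ^ 2) ∂μH[1] :=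
        ENNReal.tsum_le_tsum hB
      _ = _ := by rw [ENNReal.tsum_mul_left, ← lintegral_iUnion hBm hBd, ← hBu]
  have hlim : Tendsto (fun c : ℝ => ENNReal.ofReal (c ^ 2) *
      ∫⁻ x in A, ENNReal.ofReal (h x ^ 2) ∂μH[1]) (𝓝[>] 1)
      (𝓝 (ENNReal.ofReal ((1 : ℝ) ^ 2) * ∫⁻ x in A, ENNReal.ofReal (h x ^ 2) ∂μH[1])) := by
    refine ENNReal.Tendsto.mul_const ?_ (Or.inl (by simp))
    exact (ENNReal.continuous_ofReal.comp (continuous_pow 2)).continuousWithinAt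
  have := ge_of_tendsto hlim (eventually_nhdsWithin_of_forall fun c hc => key c hc)
  simpa using this

/-- Integral version of `hausdorffMeasure_image_le_lintegral_sq`. -/
theorem setLIntegral_image_hausdorff_le {X Y : Type*} [MetricSpace X] [MeasurableSpace X]
    [BorelSpace X] [MetricSpace Y] [MeasurableSpace Y] [BorelSpace Y] {f : X → Y} {h : X → ℝ}
    {A : Set X} (hA : MeasurableSet A) (hfm : Measurable f) (hh : Measurable h)
    (hpos : ∀ x ∈ A, 0 < h x)
    (hf : ∀ x ∈ A, ∀ y ∈ A, dist (f x) (f y) ≤ h x * h y * dist x y)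
    {g : Y → ℝ≥0∞} (hg : Measurable g) :
    ∫⁻ y in f '' A, g y ∂μH[1] ≤ ∫⁻ x in A, g (f x) * ENNReal.ofReal (h x ^ 2) ∂μH[1] := by
  have hm : Measurable fun x => ENNReal.ofReal (h x ^ 2) := by fun_prop
  -- The bound on measures, applied to `A ∩ f ⁻¹' B` for every measurable `B`, is an inequality
  -- between measures on `Y`.
  have hle : (μH[1] : Measure Y).restrict (f '' A) ≤
      (((μH[1] : Measure X).restrict A).withDensity fun x => ENNReal.ofReal (h x ^ 2)).map f := by
    refine Measure.le_iff.2 fun B hB => ?_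
    rw [Measure.restrict_apply hB, Measure.map_apply hfm hB, withDensity_apply _ (hfm hB),
      Measure.restrict_restrict (hfm hB), inter_comm, ← image_inter_preimage, inter_comm A]
    exact hausdorffMeasure_image_le_lintegral_sq ((hfm hB).inter hA) hh
      (fun x hx => hpos x hx.2) fun x hx y hy => hf x hx.2 y hy.2
  refine (lintegral_mono' hle le_rfl).trans (le_of_eq ?_)
  rw [lintegral_map hg hfm, lintegral_withDensity_eq_lintegral_mul (g := fun x => g (f x)) _ hm
    (hg.comp hfm)]
  simp only [Pi.mul_apply, mul_comm]

/-! ### Stereographic coordinates and the volume of the sphere -/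

/-- `1 + ‖p‖²` for `p ∈ ℝ³`. -/
def onePlusSq (p : ℝ × ℝ × ℝ) : ℝ := 1 + p.1 ^ 2 + p.2.1 ^ 2 + p.2.2 ^ 2

theorem onePlusSq_pos (p : ℝ × ℝ × ℝ) : 0 < onePlusSq p := by unfold onePlusSq; positivity

@[fun_prop]
theorem continuous_onePlusSq : Continuous onePlusSq := by unfold onePlusSq; fun_prop

/-- Inverse stereographic projection `ℝ³ → 𝕊³` in coordinates. -/
noncomputable def stereoCoord (p : ℝ × ℝ × ℝ) : Fin 4 → ℝ :=
  ![1 - 2 * (onePlusSq p)⁻¹, 2 * p.1 * (onePlusSq p)⁻¹, 2 * p.2.1 * (onePlusSq p)⁻¹,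
    2 * p.2.2 * (onePlusSq p)⁻¹]

theorem onePlusSq_mul_inv (p : ℝ × ℝ × ℝ) :
    (1 + p.1 ^ 2 + p.2.1 ^ 2 + p.2.2 ^ 2) * (onePlusSq p)⁻¹ = 1 :=
  mul_inv_cancel₀ (onePlusSq_pos p).ne'

theorem continuous_stereoCoord : Continuous stereoCoord := by
  have h : Continuous fun p => (onePlusSq p)⁻¹ :=
    continuous_onePlusSq.inv₀ fun p => (onePlusSq_pos p).ne'
  refine continuous_pi fun i => ?_
  fin_cases i <;> simp [stereoCoord] <;> fun_prop

theorem sum_stereoCoord_sq (p : ℝ × ℝ × ℝ) : ∑ i, stereoCoord p i ^ 2 = 1 := by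
  have h := onePlusSq_mul_inv p
  simp only [Fin.sum_univ_four, stereoCoord, Matrix.cons_val]
  linear_combination 4 * (onePlusSq p)⁻¹ * h

theorem stereoCoord_injective : Function.Injective stereoCoord := by
  intro p q h
  have h0 : (onePlusSq p)⁻¹ = (onePlusSq q)⁻¹ := by
    have := congrFun h 0
    simp only [stereoCoord, Matrix.cons_val] at this
    linarith
  have hq : (onePlusSq q)⁻¹ ≠ 0 := inv_ne_zero (onePlusSq_pos q).ne'
  have h1 := congrFun h 1
  have h2 := congrFun h 2
  have h3 := congrFun h 3
  simp only [stereoCoord, Matrix.cons_val, h0, mul_eq_mul_right_iff, hq, or_false,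
    mul_eq_mul_left_iff, two_ne_zero] at h1 h2 h3
  ext <;> assumption

/-- The cone over inverse stereographic projection. -/
noncomputable def stereoCone (v : Fin 4 → ℝ) : Fin 4 → ℝ := v 0 • stereoCoord (v 1, v 2, v 3)

/-- The Jacobian matrix of `stereoCone`. -/
noncomputable def stereoConeJacobian (v : Fin 4 → ℝ) : Matrix (Fin 4) (Fin 4) ℝ :=
  let m := (onePlusSq (v 1, v 2, v 3))⁻¹
  !![1 - 2 * m, v 0 * (4 * v 1 * m ^ 2), v 0 * (4 * v 2 * m ^ 2), v 0 * (4 * v 3 * m ^ 2);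
    2 * v 1 * m, v 0 * (2 * m - 4 * v 1 * v 1 * m ^ 2), v 0 * (-(4 * v 1 * v 2 * m ^ 2)),
      v 0 * (-(4 * v 1 * v 3 * m ^ 2));
    2 * v 2 * m, v 0 * (-(4 * v 2 * v 1 * m ^ 2)), v 0 * (2 * m - 4 * v 2 * v 2 * m ^ 2),
      v 0 * (-(4 * v 2 * v 3 * m ^ 2));
    2 * v 3 * m, v 0 * (-(4 * v 3 * v 1 * m ^ 2)), v 0 * (-(4 * v 3 * v 2 * m ^ 2)),
      v 0 * (2 * m - 4 * v 3 * v 3 * m ^ 2)]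

/-- The radial column is a unit vector orthogonal to the other three, which are mutually orthogonal
of length `v 0` times the conformal factor. The sign is the orientation. -/
theorem det_stereoConeJacobian (v : Fin 4 → ℝ) :
    (stereoConeJacobian v).det = -(v 0 * (2 / onePlusSq (v 1, v 2, v 3))) ^ 3 := by
  have h := onePlusSq_mul_inv (v 1, v 2, v 3)
  simp only at h
  rw [div_eq_mul_inv]
  unfold stereoConeJacobian
  generalize (onePlusSq (v 1, v 2, v 3))⁻¹ = m at h ⊢
  simp only [Matrix.det_succ_row_zero, Fin.sum_univ_succ, Matrix.of_apply,
    Matrix.submatrix_apply, Fin.succAbove, Matrix.cons_val, Matrix.cons_val_succ]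
  simp
  linear_combination (-2) * (2 * m * v 0) ^ 3 * h

theorem hasFDerivAt_stereoCone (v : Fin 4 → ℝ) :
    HasFDerivAt stereoCone
      (LinearMap.toContinuousLinearMap (Matrix.toLin' (stereoConeJacobian v))) v := by
  have hv : ∀ i : Fin 4, HasFDerivAt (fun w : Fin 4 → ℝ => w i)
      (ContinuousLinearMap.proj (R := ℝ) (φ := fun _ : Fin 4 => ℝ) i) v :=
    fun i => hasFDerivAt_apply i v
  have hn : HasFDerivAt (fun w : Fin 4 → ℝ => onePlusSq (w 1, w 2, w 3)) _ v :=
    (((hasFDerivAt_const (1 : ℝ) v).add ((hv 1).pow 2)).add ((hv 2).pow 2)).add ((hv 3).pow 2)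
  have hm : HasFDerivAt (fun w : Fin 4 → ℝ => (onePlusSq (w 1, w 2, w 3))⁻¹) _ v :=
    (hasDerivAt_inv (onePlusSq_pos (v 1, v 2, v 3)).ne').comp_hasFDerivAt v hn
  refine hasFDerivAt_pi'.2 fun i => ?_
  fin_cases i
  · have h : HasFDerivAt (fun w : Fin 4 → ℝ => w 0 * (1 - 2 * (onePlusSq (w 1, w 2, w 3))⁻¹)) _ v :=
      (hv 0).mul ((hm.const_mul 2).const_sub 1)
    refine h.congr_fderiv ?_
    ext w
    simp [stereoConeJacobian, dotProduct, Fin.sum_univ_four]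
    ring
  · have h : HasFDerivAt (fun w : Fin 4 → ℝ => w 0 * (2 * w 1 * (onePlusSq (w 1, w 2, w 3))⁻¹)) _ v :=
      (hv 0).mul (((hv 1).const_mul 2).mul hm)
    refine h.congr_fderiv ?_
    ext w
    simp [stereoConeJacobian, dotProduct, Fin.sum_univ_four]
    ring
  · have h : HasFDerivAt (fun w : Fin 4 → ℝ => w 0 * (2 * w 2 * (onePlusSq (w 1, w 2, w 3))⁻¹)) _ v :=
      (hv 0).mul (((hv 2).const_mul 2).mul hm)
    refine h.congr_fderiv ?_
    ext w
    simp [stereoConeJacobian, dotProduct, Fin.sum_univ_four]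
    ring
  · have h : HasFDerivAt (fun w : Fin 4 → ℝ => w 0 * (2 * w 3 * (onePlusSq (w 1, w 2, w 3))⁻¹)) _ v :=
      (hv 0).mul (((hv 3).const_mul 2).mul hm)
    refine h.congr_fderiv ?_
    ext w
    simp [stereoConeJacobian, dotProduct, Fin.sum_univ_four]
    ring

theorem stereoCone_injOn : InjOn stereoCone {v | 0 < v 0} := by
  intro v hv w hw h
  have hsq : ∀ u : Fin 4 → ℝ, ∑ i, stereoCone u i ^ 2 = u 0 ^ 2 := by
    intro u
    simp only [stereoCone, Pi.smul_apply, smul_eq_mul, mul_pow]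
    rw [← Finset.mul_sum, sum_stereoCoord_sq, mul_one]
  have h0 : v 0 = w 0 := by
    have := (hsq v).symm.trans ((congrArg (fun u : Fin 4 → ℝ => ∑ i, u i ^ 2) h).trans (hsq w))
    exact (pow_left_inj₀ (le_of_lt hv) (le_of_lt hw) two_ne_zero).1 this
  have h1 : stereoCoord (v 1, v 2, v 3) = stereoCoord (w 1, w 2, w 3) := by
    have hw' : w 0 ≠ 0 := ne_of_gt hw
    simp only [stereoCone, h0] at h
    exact smul_right_injective _ hw' h
  have h2 := stereoCoord_injective h1
  simp only [Prod.mk.injEq] at h2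
  ext i
  fin_cases i
  exacts [h0, h2.1, h2.2.1, h2.2.2]

/-- Inverse stereographic projection `ℝ³ → 𝕊³` from the pole `b 0`, with respect to an orthonormal
basis `b` of `ℝ⁴`. -/
noncomputable def stereo (b : OrthonormalBasis (Fin 4) ℝ (EuclideanSpace ℝ (Fin 4)))
    (p : ℝ × ℝ × ℝ) : S3 :=
  ⟨b.repr.symm (WithLp.toLp 2 (stereoCoord p)), by
    rw [mem_sphere_zero_iff_norm, LinearIsometryEquiv.norm_map, EuclideanSpace.norm_eq]
    simp [sum_stereoCoord_sq]⟩

theorem repr_stereo (b : OrthonormalBasis (Fin 4) ℝ (EuclideanSpace ℝ (Fin 4)))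
    (p : ℝ × ℝ × ℝ) : (b.repr (stereo b p).1).ofLp = stereoCoord p := by
  simp [stereo]

theorem continuous_stereo (b : OrthonormalBasis (Fin 4) ℝ (EuclideanSpace ℝ (Fin 4))) :
    Continuous (stereo b) := by
  refine Continuous.subtype_mk ?_ _
  exact b.repr.symm.continuous.comp ((PiLp.continuous_toLp 2 _).comp continuous_stereoCoord)

/-- Stereographic projection is a right inverse of `stereoCoord` away from the pole. -/
theorem stereoCoord_project {y : Fin 4 → ℝ} (hy : ∑ i, y i ^ 2 = 1) (h : y 0 ≠ 1) :
    stereoCoord (y 1 / (1 - y 0), y 2 / (1 - y 0), y 3 / (1 - y 0)) = y := by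
  have h0 : 1 - y 0 ≠ 0 := sub_ne_zero.2 h.symm
  rw [Fin.sum_univ_four] at hy
  have hn : (onePlusSq (y 1 / (1 - y 0), y 2 / (1 - y 0), y 3 / (1 - y 0)))⁻¹ = (1 - y 0) / 2 := by
    rw [inv_eq_iff_eq_inv, inv_div, onePlusSq]
    field_simp
    linear_combination hy
  ext i
  fin_cases i <;> simp only [stereoCoord, hn] <;> simp <;> field_simp
  ring

theorem measurePreserving_repr (b : OrthonormalBasis (Fin 4) ℝ (EuclideanSpace ℝ (Fin 4))) :
    MeasurePreserving (fun x => (b.repr x).ofLp) volume volume :=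
  (PiLp.volume_preserving_ofLp (Fin 4)).comp b.repr.measurePreserving

theorem measurePreserving_finFour :
    MeasurePreserving (fun v : Fin 4 → ℝ => (v 0, v 1, v 2, v 3))
      volume (volume : Measure (ℝ × ℝ × ℝ × ℝ)) := by
  have h4 := volume_preserving_piFinSuccAbove (fun _ : Fin 4 => ℝ) 0
  have h3 := volume_preserving_piFinSuccAbove (fun _ : Fin 3 => ℝ) 0
  have h2 := volume_preserving_finTwoArrow ℝ
  exact (((MeasurePreserving.id volume).prod ((MeasurePreserving.id volume).prod h2)).comp
    ((MeasurePreserving.id volume).prod h3)).comp h4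

/-- Change of variables for the cone; the factor `4⁻¹` is the radial integral of `r ^ 3`. -/
theorem volume_stereoCone_image {s : Set (ℝ × ℝ × ℝ)} (hs : MeasurableSet s) :
    volume (stereoCone '' {v | v 0 ∈ Ioo (0 : ℝ) 1 ∧ (v 1, v 2, v 3) ∈ s}) =
      4⁻¹ * ∫⁻ p in s, ENNReal.ofReal ((2 / onePlusSq p) ^ 3) := by
  have hψ := measurePreserving_finFour
  have hA : {v : Fin 4 → ℝ | v 0 ∈ Ioo (0 : ℝ) 1 ∧ (v 1, v 2, v 3) ∈ s} =
      (fun v : Fin 4 → ℝ => (v 0, v 1, v 2, v 3)) ⁻¹' (Ioo (0 : ℝ) 1 ×ˢ s) := rfl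
  have hAm : MeasurableSet {v : Fin 4 → ℝ | v 0 ∈ Ioo (0 : ℝ) 1 ∧ (v 1, v 2, v 3) ∈ s} := by
    rw [hA]; exact hψ.measurable (measurableSet_Ioo.prod hs)
  rw [← lintegral_abs_det_fderiv_eq_addHaar_image volume hAm
    (fun v _ => (hasFDerivAt_stereoCone v).hasFDerivWithinAt)
    (stereoCone_injOn.mono fun v hv => hv.1.1)]
  have hF1 : Measurable fun r : ℝ => ENNReal.ofReal (r ^ 3) := by fun_prop
  have hF2 : Measurable fun p => ENNReal.ofReal ((2 / onePlusSq p) ^ 3) := by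
    have := continuous_onePlusSq.measurable
    fun_prop
  have hdet : ∀ v ∈ {v : Fin 4 → ℝ | v 0 ∈ Ioo (0 : ℝ) 1 ∧ (v 1, v 2, v 3) ∈ s},
      ENNReal.ofReal |(LinearMap.toContinuousLinearMap
        (Matrix.toLin' (stereoConeJacobian v))).det| =
      (fun q : ℝ × ℝ × ℝ × ℝ => ENNReal.ofReal (q.1 ^ 3) *
        ENNReal.ofReal ((2 / onePlusSq q.2) ^ 3)) (v 0, v 1, v 2, v 3) := by
    intro v hv
    have h0 : 0 < v 0 := hv.1.1
    have h1 := onePlusSq_pos (v 1, v 2, v 3)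
    rw [LinearMap.det_toContinuousLinearMap, LinearMap.det_toLin', det_stereoConeJacobian,
      abs_neg, abs_of_nonneg (by positivity), mul_pow, ENNReal.ofReal_mul (by positivity)]
  rw [setLIntegral_congr_fun hAm hdet, hA,
    hψ.setLIntegral_comp_preimage (f := fun q : ℝ × ℝ × ℝ × ℝ => ENNReal.ofReal (q.1 ^ 3) *
      ENNReal.ofReal ((2 / onePlusSq q.2) ^ 3)) (measurableSet_Ioo.prod hs)
      ((hF1.comp measurable_fst).mul (hF2.comp measurable_snd)),
    Measure.volume_eq_prod, ← Measure.prod_restrict,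
    lintegral_prod_mul hF1.aemeasurable hF2.aemeasurable]
  congr 1
  rw [Measure.restrict_congr_set Ioo_ae_eq_Ioc, ← ofReal_integral_eq_lintegral_ofReal,
    ← intervalIntegral.integral_of_le zero_le_one, integral_pow]
  · norm_num
    rw [one_div, ENNReal.ofReal_inv_of_pos (by norm_num)]
    norm_num
  · exact (intervalIntegral.intervalIntegrable_pow 3).1
  · filter_upwards [ae_restrict_mem measurableSet_Ioc] with y hy
    exact pow_nonneg hy.1.le _

theorem volume_coord_eq_zero : volume {y : Fin 4 → ℝ | y 3 = 0} = 0 := by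
  have : {y : Fin 4 → ℝ | y 3 = 0} =
      (LinearMap.ker (LinearMap.proj (R := ℝ) (φ := fun _ : Fin 4 => ℝ) 3) : Set (Fin 4 → ℝ)) := by
    ext y; simp
  rw [this]
  apply Measure.addHaar_submodule
  rw [Ne, LinearMap.ker_eq_top]
  intro h
  have := LinearMap.congr_fun h 1
  simp at this

open scoped Pointwise in
/-- The volume of `𝕊³` in stereographic coordinates. -/
theorem volS3_eq_map_stereo (b : OrthonormalBasis (Fin 4) ℝ (EuclideanSpace ℝ (Fin 4))) :
    volS3 = (volume.withDensity fun p => ENNReal.ofReal ((2 / onePlusSq p) ^ 3)).map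
      (stereo b) := by
  have hst := (continuous_stereo b).measurable
  ext s hs
  rw [Measure.map_apply hst hs, withDensity_apply _ (hst hs), volS3, Measure.toSphere_apply' _ hs]
  have he := measurePreserving_repr b
  set e : EuclideanSpace ℝ (Fin 4) → Fin 4 → ℝ := fun x => (b.repr x).ofLp with he_def
  have hinj : Function.Injective e := (WithLp.ofLp_injective 2).comp b.repr.injective
  set A : Set (Fin 4 → ℝ) := {v | v 0 ∈ Ioo (0 : ℝ) 1 ∧ (v 1, v 2, v 3) ∈ stereo b ⁻¹' s} with hA
  have hemb : MeasurableEmbedding e :=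
    (b.repr.toHomeomorph.trans (PiLp.homeomorph 2 fun _ : Fin 4 => ℝ)).measurableEmbedding
  have hsub : e ⁻¹' (stereoCone '' A) ⊆ Ioo (0 : ℝ) 1 • ((↑) '' s) := by
    rintro x ⟨v, ⟨hv0, hvs⟩, hvx⟩
    refine Set.mem_smul.2 ⟨v 0, hv0, (stereo b (v 1, v 2, v 3)).1, ⟨_, hvs, rfl⟩, ?_⟩
    apply hinj
    rw [← hvx, he_def]
    simp only [map_smul, WithLp.ofLp_smul, repr_stereo]
    rfl
  -- The chart misses only the pole; the segment over it lies in the null hyperplane `y 3 = 0`.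
  have hsup : Ioo (0 : ℝ) 1 • ((↑) '' s) ⊆ e ⁻¹' (stereoCone '' A) ∪ e ⁻¹' {y | y 3 = 0} := by
    intro x hx
    obtain ⟨r, hr, _, ⟨z, hz, rfl⟩, rfl⟩ := Set.mem_smul.1 hx
    by_cases h3 : e (r • z.1) 3 = 0
    · exact Or.inr h3
    left
    have hyz : e (r • z.1) = r • e z.1 := by simp [he_def]
    have hsum : ∑ i, e z.1 i ^ 2 = 1 := by
      have : ‖b.repr z.1‖ = 1 := by rw [LinearIsometryEquiv.norm_map]; simp
      rw [EuclideanSpace.norm_eq, Real.sqrt_eq_one] at this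
      simpa [he_def] using this
    have h3' : e z.1 3 ≠ 0 := fun h => h3 (by rw [hyz]; simp [h])
    have h0 : e z.1 0 ≠ 1 := by
      intro h
      rw [Fin.sum_univ_four, h] at hsum
      nlinarith [sq_nonneg (e z.1 1), sq_nonneg (e z.1 2), sq_pos_of_ne_zero h3']
    have hproj := stereoCoord_project hsum h0
    refine ⟨![r, e z.1 1 / (1 - e z.1 0), e z.1 2 / (1 - e z.1 0), e z.1 3 / (1 - e z.1 0)],
      ⟨by simpa using hr, ?_⟩, ?_⟩
    · have : stereo b (e z.1 1 / (1 - e z.1 0), e z.1 2 / (1 - e z.1 0),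
          e z.1 3 / (1 - e z.1 0)) = z := by
        apply Subtype.ext
        apply hinj
        simp only [he_def, repr_stereo]
        exact hproj
      simpa [this] using hz
    · rw [hyz]
      simp only [stereoCone, Matrix.cons_val]
      rw [hproj]
  have hnull : volume (e ⁻¹' {y | y 3 = 0}) = 0 := by
    rw [he.measure_preimage_emb hemb, volume_coord_eq_zero]
  have hvol : volume (Ioo (0 : ℝ) 1 • ((↑) '' s : Set (EuclideanSpace ℝ (Fin 4)))) =
      volume (stereoCone '' A) := by
    rw [← he.measure_preimage_emb hemb]
    refine le_antisymm ?_ (measure_mono hsub)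
    refine (measure_mono hsup).trans ((measure_union_le _ _).trans ?_)
    rw [hnull, add_zero]
  rw [hvol, hA, volume_stereoCone_image (hst hs), ← mul_assoc]
  -- The dimension enters as the normalisation in `Measure.toSphere`.
  have : ((Module.finrank ℝ (EuclideanSpace ℝ (Fin 4)) : ℕ) : ℝ≥0∞) * 4⁻¹ = 1 := by
    simp only [finrank_euclideanSpace, Fintype.card_fin, Nat.cast_ofNat]
    exact ENNReal.mul_inv_cancel (by norm_num) (by norm_num)
  rw [this, one_mul]

/-- Integration over `𝕊³` in stereographic coordinates. -/
theorem lintegral_volS3_eq_stereo (b : OrthonormalBasis (Fin 4) ℝ (EuclideanSpace ℝ (Fin 4)))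
    {F : S3 → ℝ≥0∞} (hF : Measurable F) :
    ∫⁻ x, F x ∂volS3 =
      ∫⁻ p, F (stereo b p) * ENNReal.ofReal ((2 / onePlusSq p) ^ 3) := by
  have hst := (continuous_stereo b).measurable
  have hF2 : Measurable fun p => ENNReal.ofReal ((2 / onePlusSq p) ^ 3) := by
    have := continuous_onePlusSq.measurable
    fun_prop
  rw [volS3_eq_map_stereo b, lintegral_map hF hst,
    lintegral_withDensity_eq_lintegral_mul (g := fun p => F (stereo b p)) _ hF2 (hF.comp hst)]
  simp only [Pi.mul_apply, mul_comm]

/-! ### Hyperbolic polar coordinates in a half-plane, cylindrical coordinates in space -/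

/-- The squared distance of `w` to `-1` in the plane. -/
def distSqNegOne (w : ℝ × ℝ) : ℝ := (1 + w.1) ^ 2 + w.2 ^ 2

/-- The conformal map from the unit disc onto the upper half-plane which sends `0` to
`(x₀, y₀)`. -/
noncomputable def cayley (x₀ y₀ : ℝ) (w : ℝ × ℝ) : ℝ × ℝ :=
  (x₀ + y₀ * (2 * w.2 * (distSqNegOne w)⁻¹),
    y₀ * ((1 - w.1 ^ 2 - w.2 ^ 2) * (distSqNegOne w)⁻¹))

theorem distSqNegOne_pos {w : ℝ × ℝ} (hw : w.1 ^ 2 + w.2 ^ 2 < 1) : 0 < distSqNegOne w := by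
  have : -1 < w.1 := by nlinarith [sq_nonneg w.2]
  have : 0 < 1 + w.1 := by linarith
  unfold distSqNegOne
  positivity

/-- The Jacobian matrix of `cayley`. -/
noncomputable def cayleyJacobian (y₀ : ℝ) (w : ℝ × ℝ) : Matrix (Fin 2) (Fin 2) ℝ :=
  let m := (distSqNegOne w)⁻¹
  !![y₀ * (-(4 * w.2 * (1 + w.1) * m ^ 2)), y₀ * (2 * m - 4 * w.2 ^ 2 * m ^ 2);
    y₀ * (-(2 * w.1 * m) - (1 - w.1 ^ 2 - w.2 ^ 2) * (2 * (1 + w.1)) * m ^ 2),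
    y₀ * (-(2 * w.2 * m) - (1 - w.1 ^ 2 - w.2 ^ 2) * (2 * w.2) * m ^ 2)]

theorem det_cayleyJacobian (y₀ : ℝ) {w : ℝ × ℝ} (hw : 0 < distSqNegOne w) :
    (cayleyJacobian y₀ w).det = 4 * y₀ ^ 2 / distSqNegOne w ^ 2 := by
  simp only [cayleyJacobian, Matrix.det_fin_two_of]
  field_simp
  unfold distSqNegOne
  ring

theorem hasFDerivAt_cayley (x₀ y₀ : ℝ) {w : ℝ × ℝ} (hw : 0 < distSqNegOne w) :
    HasFDerivAt (cayley x₀ y₀) (LinearMap.toContinuousLinearMap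
      (Matrix.toLin (.finTwoProd ℝ) (.finTwoProd ℝ) (cayleyJacobian y₀ w))) w := by
  have h1 : HasFDerivAt (fun w : ℝ × ℝ => w.1) (ContinuousLinearMap.fst ℝ ℝ ℝ) w :=
    hasFDerivAt_fst
  have h2 : HasFDerivAt (fun w : ℝ × ℝ => w.2) (ContinuousLinearMap.snd ℝ ℝ ℝ) w :=
    hasFDerivAt_snd
  have hn : HasFDerivAt distSqNegOne _ w := ((h1.const_add 1).pow 2).add (h2.pow 2)
  have hm : HasFDerivAt (fun w => (distSqNegOne w)⁻¹) _ w :=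
    (hasDerivAt_inv hw.ne').comp_hasFDerivAt w hn
  have hx : HasFDerivAt (fun w => x₀ + y₀ * (2 * w.2 * (distSqNegOne w)⁻¹)) _ w :=
    (((h2.const_mul 2).mul hm).const_mul y₀).const_add x₀
  have hy : HasFDerivAt (fun w => y₀ * ((1 - w.1 ^ 2 - w.2 ^ 2) * (distSqNegOne w)⁻¹)) _ w :=
    ((((h1.pow 2).const_sub 1).sub (h2.pow 2)).mul hm).const_mul y₀
  refine (hx.prodMk hy).congr_fderiv ?_
  unfold cayleyJacobian
  rw [Matrix.toLin_finTwoProd_toContinuousLinearMap]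
  ext <;> simp [-mul_eq_mul_left_iff] <;> ring

/-- In complex notation `cayley` is `w ↦ x₀ + i y₀ (1 - w) / (1 + w)`, with inverse `z ↦ (i y₀ - (z
- x₀)) / (i y₀ + (z - x₀))`; `key` is this inverse in real coordinates. -/
theorem cayley_injOn (x₀ : ℝ) {y₀ : ℝ} (hy : 0 < y₀) :
    InjOn (cayley x₀ y₀) {w | w.1 ^ 2 + w.2 ^ 2 < 1} := by
  have key : ∀ w : ℝ × ℝ, w.1 ^ 2 + w.2 ^ 2 < 1 →
      let z := cayley x₀ y₀ w
      w = ((y₀ ^ 2 - (z.1 - x₀) ^ 2 - z.2 ^ 2) / ((z.1 - x₀) ^ 2 + (y₀ + z.2) ^ 2),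
        2 * y₀ * (z.1 - x₀) / ((z.1 - x₀) ^ 2 + (y₀ + z.2) ^ 2)) := by
    intro w hw z
    have hQ := distSqNegOne_pos hw
    have hN : (z.1 - x₀) ^ 2 + (y₀ + z.2) ^ 2 = 4 * y₀ ^ 2 * (distSqNegOne w)⁻¹ := by
      simp only [z, cayley]
      field_simp
      unfold distSqNegOne
      ring
    rw [hN]
    ext
    · simp only [z, cayley]
      field_simp
      unfold distSqNegOne
      ring
    · simp only [z, cayley]
      field_simp
      ring
  intro v hv w hw h
  rw [key v hv, key w hw, h]

theorem cayley_image (x₀ : ℝ) {y₀ : ℝ} (hy : 0 < y₀) :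
    cayley x₀ y₀ '' {w | w.1 ^ 2 + w.2 ^ 2 < 1} = {p | 0 < p.2} := by
  ext p
  constructor
  · rintro ⟨w, hw, rfl⟩
    have hQ := distSqNegOne_pos hw
    have : 0 < 1 - w.1 ^ 2 - w.2 ^ 2 := by
      have : w.1 ^ 2 + w.2 ^ 2 < 1 := hw
      linarith
    change 0 < y₀ * ((1 - w.1 ^ 2 - w.2 ^ 2) * (distSqNegOne w)⁻¹)
    positivity
  · intro hp
    have hp : 0 < p.2 := hp
    have hN : 0 < (p.1 - x₀) ^ 2 + (y₀ + p.2) ^ 2 := by positivity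
    set N := (p.1 - x₀) ^ 2 + (y₀ + p.2) ^ 2 with hNdef
    set w : ℝ × ℝ := ((y₀ ^ 2 - (p.1 - x₀) ^ 2 - p.2 ^ 2) / N, 2 * y₀ * (p.1 - x₀) / N) with hw
    have hQ : distSqNegOne w = 4 * y₀ ^ 2 / N := by
      simp only [distSqNegOne, hw]
      field_simp
      rw [hNdef]
      ring
    have hsq : 1 - w.1 ^ 2 - w.2 ^ 2 = 4 * y₀ * p.2 / N := by
      simp only [hw]
      field_simp
      rw [hNdef]
      ring
    refine ⟨w, ?_, ?_⟩
    · have : 0 < 4 * y₀ * p.2 / N := by positivity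
      change w.1 ^ 2 + w.2 ^ 2 < 1
      linarith
    · ext
      · simp only [cayley, hQ]
        simp only [hw]
        field_simp
        ring
      · simp only [cayley, hQ, hsq]
        field_simp

/-- Integration over the upper half-plane in hyperbolic polar coordinates. -/
theorem setLIntegral_halfPlane_eq_polar (x₀ : ℝ) {y₀ : ℝ} (hy : 0 < y₀) {F : ℝ × ℝ → ℝ≥0∞}
    (hF : Measurable F) :
    ∫⁻ p in {p : ℝ × ℝ | 0 < p.2}, F p =
      ∫⁻ θ in Ioo (-Real.pi) Real.pi, ∫⁻ t in Ioo (0 : ℝ) 1,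
        ENNReal.ofReal (4 * y₀ ^ 2 * t / distSqNegOne (t * Real.cos θ, t * Real.sin θ) ^ 2) *
          F (cayley x₀ y₀ (t * Real.cos θ, t * Real.sin θ)) := by
  have hDm : MeasurableSet {w : ℝ × ℝ | w.1 ^ 2 + w.2 ^ 2 < 1} :=
    measurableSet_lt (by fun_prop) measurable_const
  have hQm : Measurable distSqNegOne := by unfold distSqNegOne; fun_prop
  have hcm : Measurable (cayley x₀ y₀) := by unfold cayley; fun_prop
  rw [← cayley_image x₀ hy, lintegral_image_eq_lintegral_abs_det_fderiv_mul volume hDm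
    (fun w hw => (hasFDerivAt_cayley x₀ y₀ (distSqNegOne_pos hw)).hasFDerivWithinAt)
    (cayley_injOn x₀ hy)]
  have h1 : ∀ w ∈ {w : ℝ × ℝ | w.1 ^ 2 + w.2 ^ 2 < 1},
      ENNReal.ofReal |(LinearMap.toContinuousLinearMap (Matrix.toLin (.finTwoProd ℝ)
        (.finTwoProd ℝ) (cayleyJacobian y₀ w))).det| * F (cayley x₀ y₀ w) =
      ENNReal.ofReal (4 * y₀ ^ 2 / distSqNegOne w ^ 2) * F (cayley x₀ y₀ w) := by
    intro w hw
    rw [LinearMap.det_toContinuousLinearMap, LinearMap.det_toLin,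
      det_cayleyJacobian _ (distSqNegOne_pos hw), abs_of_nonneg (by positivity)]
  rw [setLIntegral_congr_fun hDm h1, ← lintegral_indicator hDm, ← lintegral_comp_polarCoord_symm,
    polarCoord_target, Measure.volume_eq_prod, ← Measure.prod_restrict]
  set G : ℝ × ℝ → ℝ≥0∞ := fun w =>
    ENNReal.ofReal (4 * y₀ ^ 2 / distSqNegOne w ^ 2) * F (cayley x₀ y₀ w) with hG
  have hGm : Measurable G := by
    refine Measurable.mul ?_ (hF.comp hcm)
    fun_prop
  rw [lintegral_prod_symm]
  swap
  · refine (Measurable.mul (by fun_prop) ?_).aemeasurable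
    exact (hGm.indicator hDm).comp continuous_polarCoord_symm.measurable
  refine lintegral_congr fun θ => ?_
  rw [← Ioo_union_Ici_eq_Ioi (zero_lt_one' ℝ), lintegral_union measurableSet_Ici
    (by rw [Set.disjoint_left]; intro t ht ht'; exact absurd ht.2 (not_lt.2 ht'))]
  have hsq : ∀ t : ℝ, (t * Real.cos θ) ^ 2 + (t * Real.sin θ) ^ 2 = t ^ 2 := by
    intro t
    linear_combination t ^ 2 * Real.sin_sq_add_cos_sq θ
  have hz : ∫⁻ t in Ici (1 : ℝ), ENNReal.ofReal (t, θ).1 •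
      indicator {w : ℝ × ℝ | w.1 ^ 2 + w.2 ^ 2 < 1} G (polarCoord.symm (t, θ)) = 0 := by
    rw [setLIntegral_congr_fun (g := fun _ => 0) measurableSet_Ici, lintegral_zero]
    intro t ht
    have ht : 1 ≤ t := ht
    simp only [polarCoord_symm_apply]
    rw [indicator_of_notMem, smul_zero]
    simp only [mem_ofPred_eq, hsq, not_lt]
    nlinarith
  rw [hz, add_zero]
  refine setLIntegral_congr_fun measurableSet_Ioo fun t ht => ?_
  simp only [polarCoord_symm_apply]
  rw [indicator_of_mem, hG, smul_eq_mul, ← mul_assoc, ← ENNReal.ofReal_mul ht.1.le]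
  · congr 2
    ring
  · simp only [mem_ofPred_eq, hsq]
    nlinarith [ht.1, ht.2]

/-- Integration over `ℝ³` in cylindrical coordinates about the axis `ℝ × {a}`. -/
theorem lintegral_eq_cylindrical (a : ℝ × ℝ) {G : ℝ × ℝ × ℝ → ℝ≥0∞} (hG : Measurable G) :
    ∫⁻ p, G p = ∫⁻ β in Ioo (-Real.pi) Real.pi, ∫⁻ p in {p : ℝ × ℝ | 0 < p.2},
      ENNReal.ofReal p.2 *
        G (p.1, a.1 + p.2 * Real.cos β, a.2 + p.2 * Real.sin β) := by
  have h1 : ∀ x : ℝ, ∫⁻ q, G (x, q) = ∫⁻ β in Ioo (-Real.pi) Real.pi, ∫⁻ y in Ioi (0 : ℝ),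
      ENNReal.ofReal y * G (x, a.1 + y * Real.cos β, a.2 + y * Real.sin β) := by
    intro x
    rw [← lintegral_add_left_eq_self (fun q => G (x, q)) a, ← lintegral_comp_polarCoord_symm,
      polarCoord_target, Measure.volume_eq_prod, ← Measure.prod_restrict, lintegral_prod_symm]
    · rfl
    · have := continuous_polarCoord_symm.measurable
      refine (Measurable.mul (by fun_prop) (hG.comp ?_)).aemeasurable
      fun_prop
  have h2 : ({p : ℝ × ℝ | 0 < p.2}) = univ ×ˢ Ioi (0 : ℝ) := by ext; simp
  rw [Measure.volume_eq_prod, lintegral_prod _ hG.aemeasurable]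
  simp_rw [h1]
  rw [lintegral_lintegral_swap]
  · refine lintegral_congr fun β => ?_
    rw [h2, Measure.volume_eq_prod, ← Measure.prod_restrict, Measure.restrict_univ, lintegral_prod]
    refine (Measurable.mul (by fun_prop) (hG.comp ?_)).aemeasurable
    fun_prop
  · apply Measurable.aemeasurable
    apply Measurable.lintegral_prod_right'
      (f := fun q : (ℝ × ℝ) × ℝ => ENNReal.ofReal q.2 *
        G (q.1.1, a.1 + q.2 * Real.cos q.1.2, a.2 + q.2 * Real.sin q.1.2))
    refine Measurable.mul (by fun_prop) (hG.comp ?_)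
    fun_prop

/-! ### Circles as lines, and the topological use of linking -/

theorem stereo_val (b : OrthonormalBasis (Fin 4) ℝ (EuclideanSpace ℝ (Fin 4))) (x y z : ℝ) :
    (stereo b (x, y, z)).1 = (1 - 2 * (onePlusSq (x, y, z))⁻¹) • b 0 +
      (2 * x * (onePlusSq (x, y, z))⁻¹) • b 1 +
      (2 * (onePlusSq (x, y, z))⁻¹) • (y • b 2 + z • b 3) := by
  simp only [stereo, stereoCoord]
  rw [← OrthonormalBasis.sum_repr_symm, Fin.sum_univ_four]
  simp only [Matrix.cons_val]
  module

-- Opposite points of the circle have equal norm, so the cross terms with `u` and `v` vanish.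
open scoped RealInnerProductSpace in
theorem circle_center_orthogonal {E : Type*} [NormedAddCommGroup E] [InnerProductSpace ℝ E]
    {c u v : E} {r : ℝ} (hr : 0 < r) (hu : ‖u‖ = 1) (hv : ‖v‖ = 1)
    (h : ∀ t : ℝ, ‖c + r • (Real.cos t • u + Real.sin t • v)‖ = 1) :
    ⟪c, u⟫ = 0 ∧ ⟪c, v⟫ = 0 ∧ ‖c‖ ^ 2 + r ^ 2 = 1 := by
  have key : ∀ w : E, ‖w‖ = 1 → ∀ k : ℝ, ‖c + k • w‖ = 1 → ‖c‖ ^ 2 + 2 * k * ⟪c, w⟫ + k ^ 2 = 1 := by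
    intro w hw k hk
    have := norm_add_sq_real c (k • w)
    rw [hk, inner_smul_right, norm_smul, hw, mul_one, Real.norm_eq_abs, sq_abs] at this
    linarith
  have h1 := key u hu r (by simpa using h 0)
  have h2 := key u hu (-r) (by simpa using h Real.pi)
  have h3 := key v hv r (by simpa using h (Real.pi / 2))
  have h4 := key v hv (-r) (by simpa using h (-(Real.pi / 2)))
  have h5 : r * ⟪c, u⟫ = 0 := by linarith
  have h6 : r * ⟪c, v⟫ = 0 := by linarith
  refine ⟨(mul_eq_zero.1 h5).resolve_left hr.ne', (mul_eq_zero.1 h6).resolve_left hr.ne', ?_⟩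
  linarith

open scoped RealInnerProductSpace in
/-- After stereographic projection from one of its points, a circle is a line. -/
theorem IsCircle.exists_stereo {C : Set S3} (hC : IsCircle C) :
    ∃ (b : OrthonormalBasis (Fin 4) ℝ (EuclideanSpace ℝ (Fin 4))) (a : ℝ × ℝ),
      ∀ x : S3, x ∈ C ↔ x.1 = b 0 ∨ ∃ s : ℝ, x = stereo b (s, a) := by
  obtain ⟨c, u, v, r, hr, huv, hCeq⟩ := hC
  have hu : ‖u‖ = 1 := huv.1 0
  have hv : ‖v‖ = 1 := huv.1 1
  have huv0 : ⟪u, v⟫ = 0 := huv.2 (i := 0) (j := 1) (by simp)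
  have hmem : ∀ x : S3, x ∈ C ↔ ∃ t : ℝ, c + r • (Real.cos t • u + Real.sin t • v) = x.1 := by
    intro x
    have : x ∈ C ↔ x.1 ∈ ((↑) '' C : Set (EuclideanSpace ℝ (Fin 4))) :=
      (Function.Injective.mem_set_image Subtype.val_injective).symm
    rw [this, hCeq, mem_range]
  have hnorm : ∀ t : ℝ, ‖c + r • (Real.cos t • u + Real.sin t • v)‖ = 1 := by
    intro t
    have : c + r • (Real.cos t • u + Real.sin t • v) ∈
        ((↑) '' C : Set (EuclideanSpace ℝ (Fin 4))) := hCeq ▸ mem_range_self t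
    obtain ⟨x, -, hx⟩ := this
    rw [← hx]
    simp
  obtain ⟨hcu, hcv, hcr⟩ := circle_center_orthogonal hr hu hv hnorm
  -- The pole is the point with `t = 0`, and `v` is the tangent direction of the circle there.
  set q := c + r • u with hq
  have hqn : ‖q‖ = 1 := by simpa using hnorm 0
  have hqv : ⟪q, v⟫ = 0 := by rw [hq, inner_add_left, inner_smul_left, hcv, huv0]; simp
  -- The zeros are placeholders; only the entries `0` and `1` are prescribed.
  have horth : Orthonormal ℝ (({0, 1} : Set (Fin 4)).domRestrict ![q, v, 0, 0]) := by
    constructor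
    · rintro ⟨i, rfl | rfl⟩
      · exact hqn
      · exact hv
    · rintro ⟨i, rfl | rfl⟩ ⟨j, rfl | rfl⟩ hij
      · exact absurd rfl hij
      · exact hqv
      · exact (real_inner_comm _ _).trans hqv
      · exact absurd rfl hij
  obtain ⟨b, hb⟩ := horth.exists_orthonormalBasis_extension_of_card_eq (by simp)
  have hb0 : b 0 = q := by simpa using hb 0 (by simp)
  have hb1 : b 1 = v := by simpa using hb 1 (by simp)
  -- The point of the line nearest to the origin: it is orthogonal to `q` and `v`, and corresponds
  -- to `c - r • u`, the point of the circle opposite to the pole.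
  set a : EuclideanSpace ℝ (Fin 4) := q - r⁻¹ • u with ha
  have hqu : ⟪q, u⟫ = r := by
    rw [hq, inner_add_left, inner_smul_left, hcu, real_inner_self_eq_norm_sq, hu]; simp
  have ha0 : ⟪q, a⟫ = 0 := by
    rw [ha, inner_sub_right, inner_smul_right, hqu, real_inner_self_eq_norm_sq, hqn]
    field_simp; simp
  have ha1 : ⟪v, a⟫ = 0 := by
    rw [ha, inner_sub_right, inner_smul_right, real_inner_comm, hqv, real_inner_comm, huv0]; simp
  have hasum : ⟪b 2, a⟫ • b 2 + ⟪b 3, a⟫ • b 3 = a := by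
    have := b.sum_repr' a
    rw [Fin.sum_univ_four, hb0, hb1, ha0, ha1] at this
    simpa using this
  have hasq : ⟪b 2, a⟫ ^ 2 + ⟪b 3, a⟫ ^ 2 = r⁻¹ ^ 2 - 1 := by
    have h1 := b.sum_sq_norm_inner_right a
    rw [Fin.sum_univ_four, hb0, hb1, ha0, ha1] at h1
    have h2 : ‖a‖ ^ 2 = r⁻¹ ^ 2 - 1 := by
      rw [ha, norm_sub_sq_real, inner_smul_right, hqu, norm_smul, hqn, hu, Real.norm_eq_abs,
        mul_one, sq_abs]
      field_simp; ring
    simp only [norm_zero, Real.norm_eq_abs, sq_abs] at h1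
    linarith
  have hn : ∀ s : ℝ, onePlusSq (s, ⟪b 2, a⟫, ⟪b 3, a⟫) = s ^ 2 + r⁻¹ ^ 2 := by
    intro s
    simp only [onePlusSq]
    linarith
  have hst : ∀ s : ℝ, (stereo b (s, ⟪b 2, a⟫, ⟪b 3, a⟫)).1 =
      c + r • ((1 - 2 * (1 + (s * r) ^ 2)⁻¹) • u + (2 * (s * r) * (1 + (s * r) ^ 2)⁻¹) • v) := by
    intro s
    have hm : (s ^ 2 + r⁻¹ ^ 2)⁻¹ = r ^ 2 * (1 + (s * r) ^ 2)⁻¹ := by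
      field_simp; ring
    rw [stereo_val, hasum, hn, hm, hb0, hb1]
    have hra : a = c + (r - r⁻¹) • u := by rw [ha, hq]; module
    rw [hra, hq]
    match_scalars <;> field_simp <;> ring
  refine ⟨b, (⟪b 2, a⟫, ⟪b 3, a⟫), fun x => ?_⟩
  rw [hmem, hb0]
  constructor
  · rintro ⟨t, ht⟩
    by_cases hc1 : Real.cos t = 1
    · left
      have hs : Real.sin t = 0 := by
        have := Real.sin_sq_add_cos_sq t
        rw [hc1] at this
        nlinarith
      rw [← ht, hc1, hs, hq]
      simp
    · right
      have h1 : 1 - Real.cos t ≠ 0 := sub_ne_zero.2 (Ne.symm hc1)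
      -- This is `cot (t / 2) / r`: the position on the line and the angle are related by `s * r =
      -- cot (t / 2)`.
      refine ⟨Real.sin t / (r * (1 - Real.cos t)), Subtype.ext ?_⟩
      have hk : Real.sin t / (r * (1 - Real.cos t)) * r = Real.sin t / (1 - Real.cos t) := by
        field_simp
      have hm : (1 + (Real.sin t / (1 - Real.cos t)) ^ 2)⁻¹ = (1 - Real.cos t) / 2 := by
        rw [inv_eq_iff_eq_inv, inv_div]
        field_simp
        linear_combination Real.sin_sq_add_cos_sq t
      rw [hst, hk, hm, ← ht]
      congr 4
      · ring
      · field_simp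
  · rintro (h | ⟨s, rfl⟩)
    · exact ⟨0, by rw [h, hq]; simp⟩
    · refine ⟨Real.pi - 2 * Real.arctan (s * r), ?_⟩
      rw [hst, Real.cos_pi_sub, Real.sin_pi_sub, Real.cos_two_mul, Real.sin_two_mul,
        Real.cos_sq_arctan]
      have : 2 * Real.sin (Real.arctan (s * r)) * Real.cos (Real.arctan (s * r)) =
          2 * (s * r) * (1 + (s * r) ^ 2)⁻¹ := by
        have h1 : Real.sin (Real.arctan (s * r)) =
            (s * r) * Real.cos (Real.arctan (s * r)) := by
          rw [← Real.tan_mul_cos (Real.cos_arctan_pos _).ne', Real.tan_arctan]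
        rw [h1]
        have := Real.cos_sq_arctan (s * r)
        rw [one_div] at this
        rw [← this]; ring
      rw [this]
      congr 4
      ring

theorem stereo_ne_pole (b : OrthonormalBasis (Fin 4) ℝ (EuclideanSpace ℝ (Fin 4)))
    (p : ℝ × ℝ × ℝ) : (stereo b p).1 ≠ b 0 := by
  intro h
  have h1 := congrFun (repr_stereo b p) 0
  rw [h] at h1
  have := inv_pos.2 (onePlusSq_pos p)
  simp [stereoCoord] at h1
  linarith

theorem stereo_injective (b : OrthonormalBasis (Fin 4) ℝ (EuclideanSpace ℝ (Fin 4))) :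
    Function.Injective (stereo b) := by
  intro p q h
  apply stereoCoord_injective
  rw [← repr_stereo b, ← repr_stereo b, h]

/-- Stereographic projection from `b 0`. -/
noncomputable def stereoProj (b : OrthonormalBasis (Fin 4) ℝ (EuclideanSpace ℝ (Fin 4)))
    (x : S3) : ℝ × ℝ × ℝ :=
  (b.repr x.1 1 / (1 - b.repr x.1 0), b.repr x.1 2 / (1 - b.repr x.1 0),
    b.repr x.1 3 / (1 - b.repr x.1 0))

theorem sum_repr_sq (b : OrthonormalBasis (Fin 4) ℝ (EuclideanSpace ℝ (Fin 4))) (x : S3) :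
    ∑ i, b.repr x.1 i ^ 2 = 1 := by
  have : ‖b.repr x.1‖ = 1 := by rw [LinearIsometryEquiv.norm_map]; simp
  rw [EuclideanSpace.norm_eq, Real.sqrt_eq_one] at this
  simpa using this

theorem repr_zero_ne_one (b : OrthonormalBasis (Fin 4) ℝ (EuclideanSpace ℝ (Fin 4))) {x : S3}
    (hx : x.1 ≠ b 0) : b.repr x.1 0 ≠ 1 := by
  intro h
  apply hx
  have hs := sum_repr_sq b x
  rw [Fin.sum_univ_four, h] at hs
  apply b.repr.injective
  ext i
  rw [OrthonormalBasis.repr_self]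
  have h1 : b.repr x.1 1 = 0 := by
    nlinarith [sq_nonneg (b.repr x.1 1), sq_nonneg (b.repr x.1 2), sq_nonneg (b.repr x.1 3)]
  have h2 : b.repr x.1 2 = 0 := by
    nlinarith [sq_nonneg (b.repr x.1 1), sq_nonneg (b.repr x.1 2), sq_nonneg (b.repr x.1 3)]
  have h3 : b.repr x.1 3 = 0 := by
    nlinarith [sq_nonneg (b.repr x.1 1), sq_nonneg (b.repr x.1 2), sq_nonneg (b.repr x.1 3)]
  fin_cases i <;> simp [h, h1, h2, h3]

theorem stereo_stereoProj (b : OrthonormalBasis (Fin 4) ℝ (EuclideanSpace ℝ (Fin 4))) {x : S3}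
    (hx : x.1 ≠ b 0) : stereo b (stereoProj b x) = x := by
  apply Subtype.ext
  apply b.repr.injective
  apply WithLp.ofLp_injective
  rw [repr_stereo]
  exact stereoCoord_project (sum_repr_sq b x) (repr_zero_ne_one b hx)

theorem continuousOn_stereoProj (b : OrthonormalBasis (Fin 4) ℝ (EuclideanSpace ℝ (Fin 4))) :
    ContinuousOn (stereoProj b) {x | x.1 ≠ b 0} := by
  have h : ∀ i, Continuous fun x : S3 => b.repr x.1 i := fun i => by fun_prop
  have h0 : ∀ x ∈ {x : S3 | x.1 ≠ b 0}, 1 - b.repr x.1 0 ≠ 0 :=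
    fun x hx => sub_ne_zero.2 (repr_zero_ne_one b hx).symm
  have hd : ContinuousOn (fun x : S3 => 1 - b.repr x.1 0) {x | x.1 ≠ b 0} :=
    (continuous_const.sub (h 0)).continuousOn
  exact ((h 1).continuousOn.div hd h0).prodMk
    (((h 2).continuousOn.div hd h0).prodMk ((h 3).continuousOn.div hd h0))

/-- A set that is not null-homotopic in the complement of a circle meets each open half-plane
bounded by the line that is the stereographic image of the circle. -/
theorem exists_mem_halfPlane_of_not_nullhomotopicIn {C D : Set S3}
    {b : OrthonormalBasis (Fin 4) ℝ (EuclideanSpace ℝ (Fin 4))} {a : ℝ × ℝ}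
    (hC : ∀ x : S3, x ∈ C ↔ x.1 = b 0 ∨ ∃ s : ℝ, x = stereo b (s, a))
    (hDC : D ⊆ Cᶜ) (hD : ¬ NullhomotopicIn D Cᶜ) (β : ℝ) :
    ∃ x y : ℝ, 0 < y ∧ stereo b (x, a.1 + y * Real.cos β, a.2 + y * Real.sin β) ∈ D := by
  by_contra! hcon
  apply hD
  have hpole : ∀ x : D, x.1.1 ≠ b 0 := fun x h => hDC x.2 ((hC _).2 (Or.inl h))
  -- A point of the opposite half-plane. A segment to `w₀` can meet the axis only if it starts on
  -- the axis or in the half-plane with angle `β`, so the straight-line homotopy stays off `C`.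
  let w₀ : ℝ × ℝ × ℝ := (0, a.1 - Real.cos β, a.2 - Real.sin β)
  let W : I × D → ℝ × ℝ × ℝ := fun p => (1 - (p.1 : ℝ)) • stereoProj b p.2.1 + (p.1 : ℝ) • w₀
  have hW : Continuous W := by
    have : Continuous fun p : I × D => stereoProj b p.2.1 :=
      (continuousOn_stereoProj b).comp_continuous (by fun_prop) fun p => hpole p.2
    fun_prop
  have hWC : ∀ p, stereo b (W p) ∈ Cᶜ := by
    rintro ⟨s, x⟩ hmem
    rcases (hC _).1 hmem with h | ⟨s', h⟩
    · exact stereo_ne_pole b _ h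
    have h := stereo_injective b h
    have hx := stereo_stereoProj b (hpole x)
    set z := stereoProj b x.1 with hz
    -- If the segment from `z` is on the axis at time `s`, then `z` has distance `s / (1 - s)` from
    -- the axis in direction `β`. The times `s = 1` and `s = 0` are excluded separately.
    have h1 : (1 - (s : ℝ)) * (z.2.1 - a.1) = s * Real.cos β := by
      have := congrArg (fun w => w.2.1) h
      simp [W, w₀, ← hz] at this
      linarith
    have h2 : (1 - (s : ℝ)) * (z.2.2 - a.2) = s * Real.sin β := by
      have := congrArg (fun w => w.2.2) h
      simp [W, w₀, ← hz] at this
      linarith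
    rcases eq_or_lt_of_le s.2.2 with hs | hs
    · rw [hs] at h1 h2
      have := Real.sin_sq_add_cos_sq β
      simp only [sub_self, zero_mul, one_mul] at h1 h2
      rw [← h1, ← h2] at this
      norm_num at this
    · have hs' : 0 < 1 - (s : ℝ) := by linarith
      have e1 : z.2.1 = a.1 + s / (1 - s) * Real.cos β := by
        field_simp
        linarith
      have e2 : z.2.2 = a.2 + s / (1 - s) * Real.sin β := by
        field_simp
        linarith
      have hz' : z = (z.1, a.1 + s / (1 - s) * Real.cos β, a.2 + s / (1 - s) * Real.sin β) := by
        rw [← e1, ← e2]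
      rcases eq_or_lt_of_le s.2.1 with h0 | h0
      · apply hDC x.2
        refine (hC _).2 (Or.inr ⟨z.1, ?_⟩)
        rw [← hx, hz', ← h0]
        simp
      · refine hcon z.1 (s / (1 - s)) (by positivity) ?_
        rw [← hz', hx]
        exact x.2
  refine ⟨hDC, ⟨stereo b w₀, ?_⟩, ⟨⟨⟨fun p => ⟨stereo b (W p), hWC p⟩, ?_⟩, ?_, ?_⟩⟩⟩
  · intro hmem
    rcases (hC _).1 hmem with h | ⟨s', h⟩
    · exact stereo_ne_pole b _ h
    have h := stereo_injective b h
    have h1 := congrArg (fun w => w.2.1) h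
    have h2 := congrArg (fun w => w.2.2) h
    simp only [w₀, sub_eq_self] at h1 h2
    have := Real.sin_sq_add_cos_sq β
    rw [h1, h2] at this
    norm_num at this
  · exact ((continuous_stereo b).comp hW).subtype_mk _
  · intro x
    apply Subtype.ext
    simp only [W]
    simpa using stereo_stereoProj b (hpole x)
  · intro x
    apply Subtype.ext
    simp [W]

/-! ### Lower bound: Hölder's inequality along hyperbolic rays -/

/-- The weight of the hyperbolic polar coordinates of the half-plane. -/
noncomputable def polarWeight (t : ℝ) : ℝ≥0∞ := ENNReal.ofReal (t * (1 - t ^ 2) / 2)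

theorem measurable_polarWeight : Measurable polarWeight := by unfold polarWeight; fun_prop

theorem polarWeight_ne_zero {t : ℝ} (ht : t ∈ Ioo (0 : ℝ) 1) : polarWeight t ≠ 0 := by
  have h1 := ht.1
  have h2 : 0 < 1 - t ^ 2 := by nlinarith [ht.2]
  rw [polarWeight, Ne, ENNReal.ofReal_eq_zero, not_le]
  positivity

theorem polarWeight_ne_top (t : ℝ) : polarWeight t ≠ ∞ := ENNReal.ofReal_ne_top

/-- The length of a ray for the extremal density. -/
noncomputable def extremalLength : ℝ≥0∞ :=
  ∫⁻ t in Ioo (0 : ℝ) 1, polarWeight t ^ (-(1 / 2) : ℝ)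

/-- Hölder with exponents `3` and `3 / 2` for `g = (g w^(1/3)) · w^(-1/3)`, then cubing; `w` is
positive and finite on the open interval. -/
theorem inv_sq_extremalLength_le {g : ℝ → ℝ≥0∞} (hg : Measurable g)
    (h : 1 ≤ ∫⁻ t in Ioo (0 : ℝ) 1, g t) :
    1 / extremalLength ^ 2 ≤ ∫⁻ t in Ioo (0 : ℝ) 1, g t ^ (3 : ℝ) * polarWeight t := by
  have hw := measurable_polarWeight
  have hpq : Real.HolderConjugate 3 (3 / 2) := by
    rw [Real.holderConjugate_iff]; norm_num
  have hold := ENNReal.lintegral_mul_le_Lp_mul_Lq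
    (volume.restrict (Ioo (0 : ℝ) 1)) hpq
    (f := fun t => g t * polarWeight t ^ (1 / 3 : ℝ)) (g := fun t => polarWeight t ^ (-(1 / 3) : ℝ))
    (by fun_prop) (by fun_prop)
  have e1 : ∫⁻ t in Ioo (0 : ℝ) 1, ((fun t => g t * polarWeight t ^ (1 / 3 : ℝ)) *
      fun t => polarWeight t ^ (-(1 / 3) : ℝ)) t = ∫⁻ t in Ioo (0 : ℝ) 1, g t := by
    refine setLIntegral_congr_fun measurableSet_Ioo fun t ht => ?_
    simp only [Pi.mul_apply]
    rw [mul_assoc, ← ENNReal.rpow_add _ _ (polarWeight_ne_zero ht) (polarWeight_ne_top t)]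
    simp
  have e2 : ∀ t, (g t * polarWeight t ^ (1 / 3 : ℝ)) ^ (3 : ℝ) = g t ^ (3 : ℝ) * polarWeight t := by
    intro t
    rw [ENNReal.mul_rpow_of_nonneg _ _ (by norm_num), ← ENNReal.rpow_mul]
    norm_num
  have e3 : ∀ t, (polarWeight t ^ (-(1 / 3) : ℝ)) ^ (3 / 2 : ℝ) = polarWeight t ^ (-(1 / 2) : ℝ) := by
    intro t
    rw [← ENNReal.rpow_mul]
    norm_num
  rw [e1] at hold
  simp only [e2, e3] at hold
  have h3 := ENNReal.rpow_le_rpow (h.trans hold) (show (0 : ℝ) ≤ 3 by norm_num)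
  rw [ENNReal.mul_rpow_of_nonneg _ _ (by norm_num), ← ENNReal.rpow_mul, ← ENNReal.rpow_mul,
    ENNReal.one_rpow] at h3
  refine ENNReal.div_le_of_le_mul ?_
  convert h3 using 2
  · norm_num
  · rw [← ENNReal.rpow_natCast, extremalLength]
    norm_num

/-- Möbius maps distort chordal distance by the geometric mean of the conformal factors at the two
points. This identity and `cayley_dist_sq` supply the hypothesis of
`setLIntegral_image_hausdorff_le`, with `h` the square root of the factor. -/
theorem dist_stereo_sq (b : OrthonormalBasis (Fin 4) ℝ (EuclideanSpace ℝ (Fin 4)))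
    (p q : ℝ × ℝ × ℝ) :
    dist (stereo b p) (stereo b q) ^ 2 = 2 / onePlusSq p * (2 / onePlusSq q) *
      ((p.1 - q.1) ^ 2 + (p.2.1 - q.2.1) ^ 2 + (p.2.2 - q.2.2) ^ 2) := by
  rw [Subtype.dist_eq, ← b.repr.dist_map, EuclideanSpace.dist_eq, Real.sq_sqrt (by positivity),
    Fin.sum_univ_four]
  simp only [Real.dist_eq, sq_abs, repr_stereo, stereoCoord, Matrix.cons_val]
  have hp := onePlusSq_pos p
  have hq := onePlusSq_pos q
  field_simp
  unfold onePlusSq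
  ring

theorem cayley_dist_sq (x₀ y₀ : ℝ) {v w : ℝ × ℝ} (hv : 0 < distSqNegOne v)
    (hw : 0 < distSqNegOne w) :
    ((cayley x₀ y₀ v).1 - (cayley x₀ y₀ w).1) ^ 2 + ((cayley x₀ y₀ v).2 - (cayley x₀ y₀ w).2) ^ 2 =
      2 * y₀ / distSqNegOne v * (2 * y₀ / distSqNegOne w) *
        ((v.1 - w.1) ^ 2 + (v.2 - w.2) ^ 2) := by
  simp only [cayley]
  field_simp
  unfold distSqNegOne
  ring

/-- The endpoint `t = 1` is included, so that rays reach the axis. The angles `±π` are left out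
because that ray runs to `-1`, which corresponds to infinity. -/
theorem distSqNegOne_polar_pos {t θ : ℝ} (ht : t ∈ Icc (0 : ℝ) 1)
    (hθ : θ ∈ Ioo (-Real.pi) Real.pi) :
    0 < distSqNegOne (t * Real.cos θ, t * Real.sin θ) := by
  have h : -1 < Real.cos θ := by
    rw [← Real.cos_pi, ← Real.cos_abs θ]
    exact Real.cos_lt_cos_of_nonneg_of_le_pi (abs_nonneg θ) le_rfl (abs_lt.2 hθ)
  have h1 : 0 < 1 + t * Real.cos θ := by
    rcases eq_or_lt_of_le ht.1 with h0 | h0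
    · rw [← h0]; norm_num
    · nlinarith [ht.2]
  simp only [distSqNegOne]
  positivity

/-- The point of `𝕊³` with cylindrical coordinates `p` and `β` about the axis `ℝ × {a}`. -/
noncomputable def cylinderPoint (b : OrthonormalBasis (Fin 4) ℝ (EuclideanSpace ℝ (Fin 4)))
    (a : ℝ × ℝ) (β : ℝ) (p : ℝ × ℝ) : S3 :=
  stereo b (p.1, a.1 + p.2 * Real.cos β, a.2 + p.2 * Real.sin β)

/-- The conformal factor of `cylinderPoint`. -/
noncomputable def cylinderFactor (a : ℝ × ℝ) (β : ℝ) (p : ℝ × ℝ) : ℝ :=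
  2 / onePlusSq (p.1, a.1 + p.2 * Real.cos β, a.2 + p.2 * Real.sin β)

theorem cylinderFactor_pos (a : ℝ × ℝ) (β : ℝ) (p : ℝ × ℝ) : 0 < cylinderFactor a β p :=
  div_pos two_pos (onePlusSq_pos _)

theorem continuous_cylinderPoint (b : OrthonormalBasis (Fin 4) ℝ (EuclideanSpace ℝ (Fin 4)))
    (a : ℝ × ℝ) (β : ℝ) : Continuous (cylinderPoint b a β) :=
  (continuous_stereo b).comp (by fun_prop)

theorem measurable_cylinderFactor (a : ℝ × ℝ) (β : ℝ) : Measurable (cylinderFactor a β) := by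
  unfold cylinderFactor onePlusSq; fun_prop

theorem dist_cylinderPoint_sq (b : OrthonormalBasis (Fin 4) ℝ (EuclideanSpace ℝ (Fin 4)))
    (a : ℝ × ℝ) (β : ℝ) (p q : ℝ × ℝ) :
    dist (cylinderPoint b a β p) (cylinderPoint b a β q) ^ 2 =
      cylinderFactor a β p * cylinderFactor a β q * ((p.1 - q.1) ^ 2 + (p.2 - q.2) ^ 2) := by
  rw [cylinderPoint, cylinderPoint, dist_stereo_sq, cylinderFactor, cylinderFactor]
  congr 1
  linear_combination (p.2 - q.2) ^ 2 * Real.sin_sq_add_cos_sq β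

/-- Integration over `𝕊³` in cylindrical coordinates. -/
theorem lintegral_volS3_eq_cylindrical
    (b : OrthonormalBasis (Fin 4) ℝ (EuclideanSpace ℝ (Fin 4))) (a : ℝ × ℝ)
    {F : S3 → ℝ≥0∞} (hF : Measurable F) :
    ∫⁻ x, F x ∂volS3 = ∫⁻ β in Ioo (-Real.pi) Real.pi, ∫⁻ p in {p : ℝ × ℝ | 0 < p.2},
      ENNReal.ofReal p.2 *
        (F (cylinderPoint b a β p) * ENNReal.ofReal (cylinderFactor a β p ^ 3)) := by
  have hm : Measurable fun p => F (stereo b p) * ENNReal.ofReal ((2 / onePlusSq p) ^ 3) := by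
    refine (hF.comp (continuous_stereo b).measurable).mul ?_
    have := continuous_onePlusSq.measurable
    fun_prop
  rw [lintegral_volS3_eq_stereo b hF, lintegral_eq_cylindrical a hm]
  rfl

/-- The point with parameter `t` on the ray in direction `θ` that starts at the point with
cylindrical coordinates `(x₀, y₀)` and `β`, and runs to the axis. -/
noncomputable def ray (b : OrthonormalBasis (Fin 4) ℝ (EuclideanSpace ℝ (Fin 4)))
    (a : ℝ × ℝ) (β x₀ y₀ θ t : ℝ) : S3 :=
  cylinderPoint b a β (cayley x₀ y₀ (t * Real.cos θ, t * Real.sin θ))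

/-- The speed of `ray`. -/
noncomputable def raySpeed (a : ℝ × ℝ) (β x₀ y₀ θ t : ℝ) : ℝ :=
  cylinderFactor a β (cayley x₀ y₀ (t * Real.cos θ, t * Real.sin θ)) *
    (2 * y₀ / distSqNegOne (t * Real.cos θ, t * Real.sin θ))

theorem raySpeed_pos (a : ℝ × ℝ) (β x₀ : ℝ) {y₀ θ t : ℝ} (hy : 0 < y₀) (ht : t ∈ Icc (0 : ℝ) 1)
    (hθ : θ ∈ Ioo (-Real.pi) Real.pi) : 0 < raySpeed a β x₀ y₀ θ t :=
  mul_pos (cylinderFactor_pos _ _ _) (div_pos (by linarith) (distSqNegOne_polar_pos ht hθ))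

theorem dist_ray_sq (b : OrthonormalBasis (Fin 4) ℝ (EuclideanSpace ℝ (Fin 4)))
    (a : ℝ × ℝ) (β x₀ y₀ : ℝ) {θ s t : ℝ} (hs : s ∈ Icc (0 : ℝ) 1) (ht : t ∈ Icc (0 : ℝ) 1)
    (hθ : θ ∈ Ioo (-Real.pi) Real.pi) :
    dist (ray b a β x₀ y₀ θ s) (ray b a β x₀ y₀ θ t) ^ 2 =
      raySpeed a β x₀ y₀ θ s * raySpeed a β x₀ y₀ θ t * (s - t) ^ 2 := by
  rw [ray, ray, dist_cylinderPoint_sq, cayley_dist_sq _ _ (distSqNegOne_polar_pos hs hθ)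
    (distSqNegOne_polar_pos ht hθ), raySpeed, raySpeed]
  have : (s * Real.cos θ - t * Real.cos θ) ^ 2 + (s * Real.sin θ - t * Real.sin θ) ^ 2 =
      (s - t) ^ 2 := by linear_combination (s - t) ^ 2 * Real.sin_sq_add_cos_sq θ
  simp only [this]
  ring

theorem measurable_cayley (x₀ y₀ : ℝ) : Measurable (cayley x₀ y₀) := by
  unfold cayley distSqNegOne; fun_prop

theorem measurable_ray (b : OrthonormalBasis (Fin 4) ℝ (EuclideanSpace ℝ (Fin 4)))
    (a : ℝ × ℝ) (β x₀ y₀ θ : ℝ) : Measurable (ray b a β x₀ y₀ θ) :=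
  (continuous_cylinderPoint b a β).measurable.comp ((measurable_cayley x₀ y₀).comp (by fun_prop))

theorem measurable_raySpeed (a : ℝ × ℝ) (β x₀ y₀ θ : ℝ) : Measurable (raySpeed a β x₀ y₀ θ) := by
  refine Measurable.mul ?_ ?_
  · exact (measurable_cylinderFactor a β).comp ((measurable_cayley x₀ y₀).comp (by fun_prop))
  · unfold distSqNegOne; fun_prop

theorem continuousOn_ray (b : OrthonormalBasis (Fin 4) ℝ (EuclideanSpace ℝ (Fin 4)))
    (a : ℝ × ℝ) (β x₀ y₀ : ℝ) {θ : ℝ} (hθ : θ ∈ Ioo (-Real.pi) Real.pi) :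
    ContinuousOn (ray b a β x₀ y₀ θ) (Icc 0 1) := by
  refine (continuous_cylinderPoint b a β).comp_continuousOn ?_
  have hQ : ContinuousOn (fun t : ℝ => (distSqNegOne (t * Real.cos θ, t * Real.sin θ))⁻¹)
      (Icc 0 1) := by
    refine ContinuousOn.inv₀ ?_ fun t ht => (distSqNegOne_polar_pos ht hθ).ne'
    unfold distSqNegOne
    fun_prop
  unfold cayley
  fun_prop

theorem setLIntegral_image_ray_le (b : OrthonormalBasis (Fin 4) ℝ (EuclideanSpace ℝ (Fin 4)))
    (a : ℝ × ℝ) (β x₀ : ℝ) {y₀ θ : ℝ} (hy : 0 < y₀) (hθ : θ ∈ Ioo (-Real.pi) Real.pi)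
    {ρ : S3 → ℝ≥0∞} (hρ : Measurable ρ) :
    ∫⁻ x in ray b a β x₀ y₀ θ '' Icc 0 1, ρ x ∂μH[1] ≤
      ∫⁻ t in Ioo (0 : ℝ) 1, ρ (ray b a β x₀ y₀ θ t) *
        ENNReal.ofReal (raySpeed a β x₀ y₀ θ t) := by
  have h := setLIntegral_image_hausdorff_le (A := Icc (0 : ℝ) 1) (f := ray b a β x₀ y₀ θ)
    (h := fun t => √(raySpeed a β x₀ y₀ θ t)) measurableSet_Icc (measurable_ray b a β x₀ y₀ θ)
    (measurable_raySpeed a β x₀ y₀ θ).sqrt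
    (fun t ht => Real.sqrt_pos.2 (raySpeed_pos a β x₀ hy ht hθ)) (fun s hs t ht => ?_) hρ
  · rw [hausdorffMeasure_real, ← Measure.restrict_congr_set Ioo_ae_eq_Icc] at h
    refine h.trans (le_of_eq (setLIntegral_congr_fun measurableSet_Ioo fun t ht => ?_))
    rw [Real.sq_sqrt (raySpeed_pos a β x₀ hy (Ioo_subset_Icc_self ht) hθ).le]
  · have h1 := (raySpeed_pos a β x₀ hy hs hθ).le
    have h2 := (raySpeed_pos a β x₀ hy ht hθ).le
    refine abs_le_of_sq_le_sq' ?_ (by positivity) |>.2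
    rw [dist_ray_sq b a β x₀ y₀ hs ht hθ, mul_pow, mul_pow, Real.sq_sqrt h1, Real.sq_sqrt h2,
      Real.dist_eq, sq_abs]

theorem one_le_lintegral_ray {C D : Set S3}
    {b : OrthonormalBasis (Fin 4) ℝ (EuclideanSpace ℝ (Fin 4))} {a : ℝ × ℝ}
    (hC : ∀ x : S3, x ∈ C ↔ x.1 = b 0 ∨ ∃ s : ℝ, x = stereo b (s, a)) {β x₀ y₀ θ : ℝ}
    (hy : 0 < y₀) (hD : cylinderPoint b a β (x₀, y₀) ∈ D) (hθ : θ ∈ Ioo (-Real.pi) Real.pi)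
    {ρ : S3 → ℝ≥0∞} (hρ : ρ ∈ Admissible (connectingPaths C D)) :
    1 ≤ ∫⁻ t in Ioo (0 : ℝ) 1, ρ (ray b a β x₀ y₀ θ t) *
        ENNReal.ofReal (raySpeed a β x₀ y₀ θ t) := by
  -- Time is reversed by `σ`: a connecting path must start on `C`, whereas the ray starts in `D`.
  let γ : C(I, S3) := ⟨fun s => ray b a β x₀ y₀ θ (σ s : I),
    (continuousOn_ray b a β x₀ y₀ hθ).comp_continuous (by fun_prop) fun s => (σ s : I).2⟩
  have hrange : range γ = ray b a β x₀ y₀ θ '' Icc 0 1 := by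
    ext x
    constructor
    · rintro ⟨s, rfl⟩
      exact ⟨_, (σ s : I).2, rfl⟩
    · rintro ⟨t, ht, rfl⟩
      exact ⟨σ ⟨t, ht⟩, by simp [γ]⟩
  have hγ : γ ∈ connectingPaths C D := by
    constructor
    · refine (hC _).2 (Or.inr ⟨(cayley x₀ y₀ (Real.cos θ, Real.sin θ)).1, ?_⟩)
      have h0 : (cayley x₀ y₀ (Real.cos θ, Real.sin θ)).2 = 0 := by
        have := Real.sin_sq_add_cos_sq θ
        simp only [cayley]
        rw [show 1 - Real.cos θ ^ 2 - Real.sin θ ^ 2 = 0 by linarith]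
        simp
      simp [γ, ray, cylinderPoint, h0]
    · have : cayley x₀ y₀ (0, 0) = (x₀, y₀) := by simp [cayley, distSqNegOne]
      simpa [γ, ray, this] using hD
  refine (hρ.2 γ hγ).trans ?_
  rw [hrange]
  exact setLIntegral_image_ray_le b a β x₀ hy hθ hρ.1

/-- The integrand of the cylindrical coordinates of `𝕊³` in hyperbolic polar coordinates. -/
theorem cylindrical_integrand_eq {y₀ θ t : ℝ} (x₀ : ℝ) (a : ℝ × ℝ) (β : ℝ) (hy : 0 < y₀)
    (hθ : θ ∈ Ioo (-Real.pi) Real.pi) (ht : t ∈ Ioo (0 : ℝ) 1) (R : ℝ≥0∞) :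
    ENNReal.ofReal (4 * y₀ ^ 2 * t / distSqNegOne (t * Real.cos θ, t * Real.sin θ) ^ 2) *
      (ENNReal.ofReal (cayley x₀ y₀ (t * Real.cos θ, t * Real.sin θ)).2 * (R ^ (3 : ℝ) *
        ENNReal.ofReal (cylinderFactor a β
          (cayley x₀ y₀ (t * Real.cos θ, t * Real.sin θ)) ^ 3))) =
      (R * ENNReal.ofReal (raySpeed a β x₀ y₀ θ t)) ^ (3 : ℝ) * polarWeight t := by
  have ht' := Ioo_subset_Icc_self ht
  have hQ := distSqNegOne_polar_pos ht' hθ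
  have hs := (raySpeed_pos a β x₀ hy ht' hθ).le
  have hc := (cylinderFactor_pos a β (cayley x₀ y₀ (t * Real.cos θ, t * Real.sin θ))).le
  have ht0 := ht.1.le
  -- The height is `(1 - t²) / 2` times the conformal factor `2 y₀ / distSqNegOne` of `cayley`,
  -- which is therefore a hyperbolic isometry. This removes the base point from the weight.
  have hY : (cayley x₀ y₀ (t * Real.cos θ, t * Real.sin θ)).2 =
      y₀ * (1 - t ^ 2) / distSqNegOne (t * Real.cos θ, t * Real.sin θ) := by
    simp only [cayley]
    rw [show 1 - (t * Real.cos θ) ^ 2 - (t * Real.sin θ) ^ 2 = 1 - t ^ 2 by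
      linear_combination -t ^ 2 * Real.sin_sq_add_cos_sq θ]
    ring
  have h1 : 0 ≤ 1 - t ^ 2 := by nlinarith [ht.2]
  rw [ENNReal.mul_rpow_of_nonneg _ _ (by norm_num), polarWeight,
    ENNReal.ofReal_rpow_of_nonneg hs (by norm_num), hY]
  have e : ∀ A B D : ℝ≥0∞, A * (B * (R ^ (3 : ℝ) * D)) = R ^ (3 : ℝ) * (A * B * D) := by
    intro A B D; ring
  rw [e, mul_assoc (R ^ (3 : ℝ)), ← ENNReal.ofReal_mul (by positivity), ← ENNReal.ofReal_mul (by positivity),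
    ← ENNReal.ofReal_mul (by positivity)]
  congr 2
  rw [show (3 : ℝ) = (3 : ℕ) by norm_num, Real.rpow_natCast, raySpeed]
  field_simp
  ring

/-- Each direction `θ` contributes at least `1 / extremalLength ^ 2`, wherever the base point lies.
-/
theorem halfPlane_lower_bound {C D : Set S3}
    {b : OrthonormalBasis (Fin 4) ℝ (EuclideanSpace ℝ (Fin 4))} {a : ℝ × ℝ}
    (hC : ∀ x : S3, x ∈ C ↔ x.1 = b 0 ∨ ∃ s : ℝ, x = stereo b (s, a)) {β x₀ y₀ : ℝ}
    (hy : 0 < y₀) (hD : cylinderPoint b a β (x₀, y₀) ∈ D)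
    {ρ : S3 → ℝ≥0∞} (hρ : ρ ∈ Admissible (connectingPaths C D)) :
    1 / extremalLength ^ 2 * ENNReal.ofReal (2 * Real.pi) ≤
      ∫⁻ p in {p : ℝ × ℝ | 0 < p.2}, ENNReal.ofReal p.2 *
        (ρ (cylinderPoint b a β p) ^ (3 : ℝ) * ENNReal.ofReal (cylinderFactor a β p ^ 3)) := by
  have hρm := hρ.1
  have hm : Measurable fun p : ℝ × ℝ => ENNReal.ofReal p.2 *
      (ρ (cylinderPoint b a β p) ^ (3 : ℝ) * ENNReal.ofReal (cylinderFactor a β p ^ 3)) := by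
    have h1 := (continuous_cylinderPoint b a β).measurable
    have h2 := measurable_cylinderFactor a β
    fun_prop
  rw [setLIntegral_halfPlane_eq_polar x₀ hy hm]
  have hle : ∫⁻ _ in Ioo (-Real.pi) Real.pi, 1 / extremalLength ^ 2 ≤
      ∫⁻ θ in Ioo (-Real.pi) Real.pi, ∫⁻ t in Ioo (0 : ℝ) 1,
        ENNReal.ofReal (4 * y₀ ^ 2 * t / distSqNegOne (t * Real.cos θ, t * Real.sin θ) ^ 2) *
          (ENNReal.ofReal (cayley x₀ y₀ (t * Real.cos θ, t * Real.sin θ)).2 *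
            (ρ (cylinderPoint b a β (cayley x₀ y₀ (t * Real.cos θ, t * Real.sin θ))) ^ (3 : ℝ) *
            ENNReal.ofReal (cylinderFactor a β
              (cayley x₀ y₀ (t * Real.cos θ, t * Real.sin θ)) ^ 3))) := by
    refine setLIntegral_mono' measurableSet_Ioo fun θ hθ => ?_
    rw [setLIntegral_congr_fun measurableSet_Ioo fun t ht =>
      cylindrical_integrand_eq x₀ a β hy hθ ht _]
    refine inv_sq_extremalLength_le ?_ (one_le_lintegral_ray hC hy hD hθ hρ)
    exact (hρm.comp (measurable_ray b a β x₀ y₀ θ)).mul (measurable_raySpeed a β x₀ y₀ θ).ennreal_ofReal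
  rw [setLIntegral_const, Real.volume_Ioo, sub_neg_eq_add, ← two_mul] at hle
  exact hle

/-- Lower bound for the modulus of the paths between a circle and a set that is linked with it. -/
theorem lower_bound_pathModulus {C D : Set S3} (hC : IsCircle C) (hDC : D ⊆ Cᶜ)
    (hD : ¬ NullhomotopicIn D Cᶜ) :
    1 / extremalLength ^ 2 * ENNReal.ofReal (2 * Real.pi) * ENNReal.ofReal (2 * Real.pi) ≤
      pathModulus 3 (connectingPaths C D) := by
  obtain ⟨b, a, hCb⟩ := hC.exists_stereo
  refine le_iInf₂ fun ρ hρ => ?_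
  have hρm := hρ.1
  rw [lintegral_volS3_eq_cylindrical b a (by fun_prop)]
  -- The bound does not involve the point `(x₀, y₀)`, so the point may be chosen for each `β` with
  -- no measurability in `β`.
  have hle := setLIntegral_mono' (μ := volume) (measurableSet_Ioo (a := -Real.pi) (b := Real.pi))
    fun β _ => by
      obtain ⟨x₀, y₀, hy, hmem⟩ := exists_mem_halfPlane_of_not_nullhomotopicIn hCb hDC hD β
      exact halfPlane_lower_bound (x₀ := x₀) hCb hy hmem hρ
  rw [setLIntegral_const, Real.volume_Ioo, sub_neg_eq_add, ← two_mul] at hle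
  exact hle

/-- There are no admissible densities if the two sets meet. -/
theorem pathModulus_eq_top_of_mem {C D : Set S3} {x : S3} (hC : x ∈ C) (hD : x ∈ D) (p : ℝ) :
    pathModulus p (connectingPaths C D) = ∞ := by
  refine iInf₂_eq_top.2 fun ρ hρ => ?_
  -- A constant path has a one-point image, which is `ℋ¹`-null.
  have h := hρ.2 (ContinuousMap.const I x) ⟨hC, hD⟩
  have := Measure.nullSingletonClass_hausdorff S3 (d := 1) one_pos
  rw [show range (ContinuousMap.const I x) = {x} by simp [ContinuousMap.const]] at h
  simp at h

/-! ### Upper bound: the extremal density of the Hopf link -/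

theorem extremalLength_ne_zero : extremalLength ≠ 0 := by
  have h : ∫⁻ _ in Ioo (0 : ℝ) 1, (1 : ℝ≥0∞) ≤ extremalLength := by
    refine setLIntegral_mono' measurableSet_Ioo fun t ht => ?_
    rw [ENNReal.rpow_neg, ENNReal.one_le_inv]
    refine ENNReal.rpow_le_one ?_ (by norm_num)
    rw [polarWeight, ENNReal.ofReal_le_one]
    nlinarith [ht.1, ht.2, mul_nonneg ht.1.le (sq_nonneg t)]
  intro h0
  rw [h0] at h
  simp at h

/-- The weight vanishes to first order at both endpoints, and `-1 / 2` is an integrable exponent; `w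
t` is at least `t / 4` on the left half and `(1 - t) / 4` on the right half. -/
theorem extremalLength_ne_top : extremalLength ≠ ∞ := by
  have hi : IntegrableOn (fun t : ℝ => t ^ (-(1 / 2) : ℝ)) (Ioo 0 1) := by
    have := intervalIntegral.intervalIntegrable_rpow' (a := 0) (b := 1)
      (r := -(1 / 2)) (by norm_num)
    exact ((intervalIntegrable_iff_integrableOn_Ioo_of_le zero_le_one).1 this)
  have hi' : IntegrableOn (fun t : ℝ => (1 - t) ^ (-(1 / 2) : ℝ)) (Ioo 0 1) := by
    have := (intervalIntegral.intervalIntegrable_rpow' (a := 0) (b := 1)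
      (r := -(1 / 2)) (by norm_num)).comp_sub_left 1
    simp only [sub_zero, sub_self] at this
    exact ((intervalIntegrable_iff_integrableOn_Ioo_of_le zero_le_one).1 this.symm)
  have hfin := ((hi.add hi').const_mul ((1 / 4 : ℝ) ^ (-(1 / 2) : ℝ))).lintegral_lt_top
  refine ne_of_lt (lt_of_le_of_lt ?_ hfin)
  refine setLIntegral_mono' measurableSet_Ioo fun t ht => ?_
  have ht0 := ht.1
  have ht1 : 0 < 1 - t := by linarith [ht.2]
  have h2 : 0 < 1 - t ^ 2 := by nlinarith [ht.2]
  rw [polarWeight, ENNReal.ofReal_rpow_of_pos (by positivity)]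
  refine ENNReal.ofReal_le_ofReal ?_
  simp only [Pi.add_apply, mul_add]
  rw [← Real.mul_rpow (by norm_num) ht0.le, ← Real.mul_rpow (by norm_num) ht1.le]
  rcases le_total t (1 / 2) with h | h
  · have h3 : (t * (1 - t ^ 2) / 2) ^ (-(1 / 2) : ℝ) ≤ (1 / 4 * t) ^ (-(1 / 2) : ℝ) := by
      refine Real.rpow_le_rpow_of_nonpos (by positivity) ?_ (by norm_num)
      nlinarith
    have : 0 ≤ (1 / 4 * (1 - t)) ^ (-(1 / 2) : ℝ) := by positivity
    linarith
  · have h3 : (t * (1 - t ^ 2) / 2) ^ (-(1 / 2) : ℝ) ≤ (1 / 4 * (1 - t)) ^ (-(1 / 2) : ℝ) := by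
      refine Real.rpow_le_rpow_of_nonpos (by positivity) ?_ (by norm_num)
      nlinarith [mul_pos ht0 ht1]
    have : 0 ≤ (1 / 4 * t) ^ (-(1 / 2) : ℝ) := by positivity
    linarith

/-- The function `|z₁| / (1 + |z₂|)` on `𝕊³`, which is `1` on `hopf₀` and `0` on `hopf₁`. -/
noncomputable def hopfParam (x : S3) : ℝ :=
  √(x.1 0 ^ 2 + x.1 1 ^ 2) / (1 + √(x.1 2 ^ 2 + x.1 3 ^ 2))

theorem continuous_hopfParam : Continuous hopfParam := by
  unfold hopfParam
  refine Continuous.div (by fun_prop) (by fun_prop) fun x => ?_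
  positivity

theorem sum_coord_sq (x : S3) : x.1 0 ^ 2 + x.1 1 ^ 2 + (x.1 2 ^ 2 + x.1 3 ^ 2) = 1 := by
  have := sum_repr_sq (EuclideanSpace.basisFun (Fin 4) ℝ) x
  rw [Fin.sum_univ_four] at this
  simp only [EuclideanSpace.basisFun_repr] at this
  linarith

theorem sq_sub_sqrt_le (p q p' q' : ℝ) :
    (√(p ^ 2 + q ^ 2) - √(p' ^ 2 + q' ^ 2)) ^ 2 ≤ (p - p') ^ 2 + (q - q') ^ 2 := by
  have h1 := Real.sq_sqrt (show 0 ≤ p ^ 2 + q ^ 2 by positivity)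
  have h2 := Real.sq_sqrt (show 0 ≤ p' ^ 2 + q' ^ 2 by positivity)
  have h3 : p * p' + q * q' ≤ √(p ^ 2 + q ^ 2) * √(p' ^ 2 + q' ^ 2) := by
    rw [← Real.sqrt_mul (by positivity)]
    refine Real.le_sqrt_of_sq_le ?_
    nlinarith [sq_nonneg (p * q' - q * p')]
  nlinarith

/-- If `α` is the spherical distance to `hopf₁`, then `(|z₁|, |z₂|) = (sin α, cos α)` and `hopfParam
= tan (α / 2)`. This is the 1-Lipschitz map `x ↦ (|z₁|, |z₂|)` to a circle followed by stereographic
projection of that circle, whose factor is `(1 + τ²) / 2 = 1 / (1 + |z₂|)`. -/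
theorem dist_hopfParam_le (x y : S3) :
    dist (hopfParam x) (hopfParam y) ≤
      √((1 + hopfParam x ^ 2) / 2) * √((1 + hopfParam y ^ 2) / 2) * dist x y := by
  refine abs_le_of_sq_le_sq' ?_ (by positivity) |>.2
  rw [mul_pow, mul_pow, Real.sq_sqrt (by positivity), Real.sq_sqrt (by positivity), Real.dist_eq,
    sq_abs]
  have hd : dist x y ^ 2 = (x.1 0 - y.1 0) ^ 2 + (x.1 1 - y.1 1) ^ 2 +
      ((x.1 2 - y.1 2) ^ 2 + (x.1 3 - y.1 3) ^ 2) := by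
    rw [Subtype.dist_eq, EuclideanSpace.dist_eq, Real.sq_sqrt (by positivity), Fin.sum_univ_four]
    simp only [Real.dist_eq, sq_abs]
    ring
  have h1 := sq_sub_sqrt_le (x.1 0) (x.1 1) (y.1 0) (y.1 1)
  have h2 := sq_sub_sqrt_le (x.1 2) (x.1 3) (y.1 2) (y.1 3)
  have hx := sum_coord_sq x
  have hy := sum_coord_sq y
  have hx1 := Real.sq_sqrt (show 0 ≤ x.1 0 ^ 2 + x.1 1 ^ 2 by positivity)
  have hx2 := Real.sq_sqrt (show 0 ≤ x.1 2 ^ 2 + x.1 3 ^ 2 by positivity)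
  have hy1 := Real.sq_sqrt (show 0 ≤ y.1 0 ^ 2 + y.1 1 ^ 2 by positivity)
  have hy2 := Real.sq_sqrt (show 0 ≤ y.1 2 ^ 2 + y.1 3 ^ 2 by positivity)
  have hx3 := Real.sqrt_nonneg (x.1 2 ^ 2 + x.1 3 ^ 2)
  have hy3 := Real.sqrt_nonneg (y.1 2 ^ 2 + y.1 3 ^ 2)
  unfold hopfParam
  generalize √(x.1 0 ^ 2 + x.1 1 ^ 2) = p at *
  generalize √(x.1 2 ^ 2 + x.1 3 ^ 2) = q at *
  generalize √(y.1 0 ^ 2 + y.1 1 ^ 2) = p' at *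
  generalize √(y.1 2 ^ 2 + y.1 3 ^ 2) = q' at *
  have hp : p ^ 2 = 1 - q ^ 2 := by linarith
  have hp' : p' ^ 2 = 1 - q' ^ 2 := by linarith
  have hq : 0 < 1 + q := by linarith
  have hq' : 0 < 1 + q' := by linarith
  have e1 : (1 + (p / (1 + q)) ^ 2) / 2 = 1 / (1 + q) := by
    rw [div_pow, hp]; field_simp; ring
  have e2 : (1 + (p' / (1 + q')) ^ 2) / 2 = 1 / (1 + q') := by
    rw [div_pow, hp']; field_simp; ring
  have e3 : (p / (1 + q) - p' / (1 + q')) ^ 2 =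
      1 / (1 + q) * (1 / (1 + q')) * ((p - p') ^ 2 + (q - q') ^ 2) := by
    field_simp
    linear_combination (1 + q') * (q' - q) * hp - (1 + q) * (q' - q) * hp'
  rw [e1, e2, e3]
  gcongr
  rw [hd]
  linarith

/-- The extremal density for the Hopf link. -/
noncomputable def hopfDensity (x : S3) : ℝ≥0∞ :=
  extremalLength⁻¹ * polarWeight (hopfParam x) ^ (-(1 / 2) : ℝ) *
    ENNReal.ofReal ((1 + hopfParam x ^ 2) / 2)

theorem measurable_hopfDensity : Measurable hopfDensity := by
  have h1 := continuous_hopfParam.measurable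
  have h2 := measurable_polarWeight
  unfold hopfDensity
  fun_prop

theorem hopfDensity_admissible : hopfDensity ∈ Admissible (connectingPaths hopf₀ hopf₁) := by
  refine ⟨measurable_hopfDensity, fun γ ⟨h0, h1⟩ => ?_⟩
  have hc := continuous_hopfParam
  have hτ0 : hopfParam (γ 0) = 1 := by
    have := sum_coord_sq (γ 0)
    simp only [hopfParam, h0.1, h0.2] at this ⊢
    norm_num at this ⊢
    rw [this]
  have hτ1 : hopfParam (γ 1) = 0 := by
    simp only [hopfParam, h1.1, h1.2]
    simp
  -- By connectedness the path takes all parameter values, so its `ρ`-length dominates the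
  -- one-dimensional integral over `(0, 1)`.
  have hsub : Icc (0 : ℝ) 1 ⊆ hopfParam '' range γ := by
    have hconn : IsPreconnected (hopfParam '' range γ) :=
      (isPreconnected_range γ.continuous).image _ hc.continuousOn
    exact hconn.Icc_subset ⟨_, mem_range_self 1, hτ1⟩ ⟨_, mem_range_self 0, hτ0⟩
  have hG : Measurable fun t => extremalLength⁻¹ * polarWeight t ^ (-(1 / 2) : ℝ) := by
    have := measurable_polarWeight
    fun_prop
  have hA : MeasurableSet (range γ) := (isCompact_range γ.continuous).isClosed.measurableSet
  have key := setLIntegral_image_hausdorff_le hA hc.measurable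
    (h := fun x => √((1 + hopfParam x ^ 2) / 2)) (by have := hc.measurable; fun_prop)
    (fun x _ => Real.sqrt_pos.2 (by positivity)) (fun x _ y _ => dist_hopfParam_le x y) hG
  have hval : ∫⁻ t in Ioo (0 : ℝ) 1, extremalLength⁻¹ * polarWeight t ^ (-(1 / 2) : ℝ) = 1 := by
    rw [lintegral_const_mul' _ _ (ENNReal.inv_ne_top.2 extremalLength_ne_zero)]
    exact ENNReal.inv_mul_cancel extremalLength_ne_zero extremalLength_ne_top
  rw [← hval]
  refine (lintegral_mono_set (Ioo_subset_Icc_self.trans hsub)).trans ?_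
  rw [hausdorffMeasure_real] at key
  refine key.trans (le_of_eq (lintegral_congr fun x => ?_))
  rw [Real.sq_sqrt (by positivity), hopfDensity]

theorem cylinderFactor_cayley {w : ℝ × ℝ} (hw : 0 < distSqNegOne w) (β : ℝ) :
    cylinderFactor (0, 0) β (cayley 0 1 w) = distSqNegOne w / (1 + w.1 ^ 2 + w.2 ^ 2) := by
  have h : onePlusSq ((cayley 0 1 w).1, 0 + (cayley 0 1 w).2 * Real.cos β,
      0 + (cayley 0 1 w).2 * Real.sin β) = 2 * (1 + w.1 ^ 2 + w.2 ^ 2) / distSqNegOne w := by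
    have : onePlusSq ((cayley 0 1 w).1, 0 + (cayley 0 1 w).2 * Real.cos β,
      0 + (cayley 0 1 w).2 * Real.sin β) = 1 + (cayley 0 1 w).1 ^ 2 + (cayley 0 1 w).2 ^ 2 := by
      simp only [onePlusSq]
      linear_combination (cayley 0 1 w).2 ^ 2 * Real.sin_sq_add_cos_sq β
    rw [this]
    simp only [cayley]
    field_simp
    unfold distSqNegOne
    ring
  rw [cylinderFactor, h]
  field_simp

/-- With `a = 0`, `hopf₀` is the axis with the pole and `hopf₁` is the unit circle around it, met by
each half-plane at `(0, 1)`. Hence `hopfParam` recovers the radial coordinate on every ray. -/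
theorem hopfParam_ray {β θ t : ℝ} (hθ : θ ∈ Ioo (-Real.pi) Real.pi) (ht : t ∈ Ioo (0 : ℝ) 1) :
    hopfParam (ray (EuclideanSpace.basisFun (Fin 4) ℝ) (0, 0) β 0 1 θ t) = t := by
  have hQ := distSqNegOne_polar_pos (Ioo_subset_Icc_self ht) hθ
  have hf := cylinderFactor_cayley hQ β
  have hsq : 1 + (t * Real.cos θ) ^ 2 + (t * Real.sin θ) ^ 2 = 1 + t ^ 2 := by
    linear_combination t ^ 2 * Real.sin_sq_add_cos_sq θ
  have hsq' : 1 - (t * Real.cos θ) ^ 2 - (t * Real.sin θ) ^ 2 = 1 - t ^ 2 := by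
    linear_combination -t ^ 2 * Real.sin_sq_add_cos_sq θ
  simp only [hsq] at hf
  set x := ray (EuclideanSpace.basisFun (Fin 4) ℝ) (0, 0) β 0 1 θ t with hx
  have h1 : 0 < 1 - t ^ 2 := by nlinarith [ht.1, ht.2]
  have h23 : x.1 2 ^ 2 + x.1 3 ^ 2 = ((1 - t ^ 2) / (1 + t ^ 2)) ^ 2 := by
    have hr := repr_stereo (EuclideanSpace.basisFun (Fin 4) ℝ)
      ((cayley 0 1 (t * Real.cos θ, t * Real.sin θ)).1,
        0 + (cayley 0 1 (t * Real.cos θ, t * Real.sin θ)).2 * Real.cos β,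
        0 + (cayley 0 1 (t * Real.cos θ, t * Real.sin θ)).2 * Real.sin β)
    have h2 := congrFun hr 2
    have h3 := congrFun hr 3
    simp only [EuclideanSpace.basisFun_repr, stereoCoord, Matrix.cons_val] at h2 h3
    have hY : (cayley 0 1 (t * Real.cos θ, t * Real.sin θ)).2 =
        (1 - t ^ 2) / distSqNegOne (t * Real.cos θ, t * Real.sin θ) := by
      simp only [cayley, hsq']
      ring
    have e : ∀ k s : ℝ, 2 * (0 + k) * s⁻¹ = 2 / s * k := by intro k s; ring
    rw [e] at h2 h3
    change x.1 2 = cylinderFactor (0, 0) β (cayley 0 1 (t * Real.cos θ, t * Real.sin θ)) * _ at h2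
    change x.1 3 = cylinderFactor (0, 0) β (cayley 0 1 (t * Real.cos θ, t * Real.sin θ)) * _ at h3
    rw [h2, h3, hf, hY]
    field_simp
    exact Real.cos_sq_add_sin_sq β
  have h01 : x.1 0 ^ 2 + x.1 1 ^ 2 = (2 * t / (1 + t ^ 2)) ^ 2 := by
    have := sum_coord_sq x
    rw [h23] at this
    rw [eq_sub_of_add_eq this]
    field_simp
    ring
  have ht0 := ht.1
  rw [hopfParam, h01, h23, Real.sqrt_sq (by positivity), Real.sqrt_sq (by positivity)]
  field_simp
  ring

/-- The factor `(1 + t²) / 2` is the reciprocal of the ray's speed; what remains is the equality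
case of `inv_sq_extremalLength_le`. -/
theorem hopfDensity_mul_raySpeed {β θ t : ℝ} (hθ : θ ∈ Ioo (-Real.pi) Real.pi)
    (ht : t ∈ Ioo (0 : ℝ) 1) :
    hopfDensity (ray (EuclideanSpace.basisFun (Fin 4) ℝ) (0, 0) β 0 1 θ t) *
      ENNReal.ofReal (raySpeed (0, 0) β 0 1 θ t) =
      extremalLength⁻¹ * polarWeight t ^ (-(1 / 2) : ℝ) := by
  have hQ := distSqNegOne_polar_pos (Ioo_subset_Icc_self ht) hθ
  have hsq : 1 + (t * Real.cos θ) ^ 2 + (t * Real.sin θ) ^ 2 = 1 + t ^ 2 := by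
    linear_combination t ^ 2 * Real.sin_sq_add_cos_sq θ
  rw [hopfDensity, hopfParam_ray hθ ht, mul_assoc, ← ENNReal.ofReal_mul (by positivity), raySpeed,
    cylinderFactor_cayley hQ]
  simp only [hsq]
  have : (1 + t ^ 2) / 2 * (distSqNegOne (t * Real.cos θ, t * Real.sin θ) / (1 + t ^ 2) *
      (2 * 1 / distSqNegOne (t * Real.cos θ, t * Real.sin θ))) = 1 := by
    field_simp
  rw [this]
  simp

/-- Upper bound for the modulus of the paths between the components of the Hopf link. -/
theorem pathModulus_hopf_le :
    pathModulus 3 (connectingPaths hopf₀ hopf₁) ≤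
      1 / extremalLength ^ 2 * ENNReal.ofReal (2 * Real.pi) * ENNReal.ofReal (2 * Real.pi) := by
  refine (iInf₂_le hopfDensity hopfDensity_admissible).trans (le_of_eq ?_)
  have hm := measurable_hopfDensity
  set b := EuclideanSpace.basisFun (Fin 4) ℝ with hb
  rw [lintegral_volS3_eq_cylindrical b (0, 0) (by fun_prop)]
  have hslice : ∀ β : ℝ, ∫⁻ p in {p : ℝ × ℝ | 0 < p.2}, ENNReal.ofReal p.2 *
      (hopfDensity (cylinderPoint b (0, 0) β p) ^ (3 : ℝ) *
        ENNReal.ofReal (cylinderFactor (0, 0) β p ^ 3)) =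
      1 / extremalLength ^ 2 * ENNReal.ofReal (2 * Real.pi) := by
    intro β
    have hpm : Measurable fun p : ℝ × ℝ => ENNReal.ofReal p.2 *
        (hopfDensity (cylinderPoint b (0, 0) β p) ^ (3 : ℝ) *
          ENNReal.ofReal (cylinderFactor (0, 0) β p ^ 3)) := by
      have h1 := (continuous_cylinderPoint b (0, 0) β).measurable
      have h2 := measurable_cylinderFactor (0, 0) β
      fun_prop
    rw [setLIntegral_halfPlane_eq_polar 0 one_pos hpm]
    have hθ : ∀ θ ∈ Ioo (-Real.pi) Real.pi, ∫⁻ t in Ioo (0 : ℝ) 1,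
        ENNReal.ofReal (4 * 1 ^ 2 * t / distSqNegOne (t * Real.cos θ, t * Real.sin θ) ^ 2) *
          (ENNReal.ofReal (cayley 0 1 (t * Real.cos θ, t * Real.sin θ)).2 *
            (hopfDensity (cylinderPoint b (0, 0) β
              (cayley 0 1 (t * Real.cos θ, t * Real.sin θ))) ^ (3 : ℝ) *
            ENNReal.ofReal (cylinderFactor (0, 0) β
              (cayley 0 1 (t * Real.cos θ, t * Real.sin θ)) ^ 3))) = 1 / extremalLength ^ 2 := by
      intro θ hθ
      have hval : ∀ t ∈ Ioo (0 : ℝ) 1,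
          ENNReal.ofReal (4 * 1 ^ 2 * t / distSqNegOne (t * Real.cos θ, t * Real.sin θ) ^ 2) *
          (ENNReal.ofReal (cayley 0 1 (t * Real.cos θ, t * Real.sin θ)).2 *
            (hopfDensity (cylinderPoint b (0, 0) β
              (cayley 0 1 (t * Real.cos θ, t * Real.sin θ))) ^ (3 : ℝ) *
            ENNReal.ofReal (cylinderFactor (0, 0) β
              (cayley 0 1 (t * Real.cos θ, t * Real.sin θ)) ^ 3))) =
          extremalLength⁻¹ ^ 3 * polarWeight t ^ (-(1 / 2) : ℝ) := by
        intro t ht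
        rw [cylindrical_integrand_eq 0 (0, 0) β one_pos hθ ht]
        change (hopfDensity (ray b (0, 0) β 0 1 θ t) * _) ^ (3 : ℝ) * _ = _
        rw [hopfDensity_mul_raySpeed hθ ht, ENNReal.mul_rpow_of_nonneg _ _ (by norm_num),
          ← ENNReal.rpow_mul, mul_assoc]
        -- The exponents add up to `-3 / 2 + 1 = -1 / 2`, the integrand of `extremalLength` again.
        nth_rewrite 2 [← ENNReal.rpow_one (polarWeight t)]
        rw [← ENNReal.rpow_add _ _ (polarWeight_ne_zero ht) (polarWeight_ne_top t)]
        norm_num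
      rw [setLIntegral_congr_fun measurableSet_Ioo hval, lintegral_const_mul' _ _
        (ENNReal.pow_ne_top (ENNReal.inv_ne_top.2 extremalLength_ne_zero))]
      change extremalLength⁻¹ ^ 3 * extremalLength = _
      rw [pow_succ, mul_assoc, ENNReal.inv_mul_cancel extremalLength_ne_zero extremalLength_ne_top,
        mul_one, one_div, ENNReal.inv_pow]
    rw [setLIntegral_congr_fun measurableSet_Ioo hθ, setLIntegral_const, Real.volume_Ioo,
      sub_neg_eq_add, ← two_mul]
  simp_rw [hslice]
  rw [setLIntegral_const, Real.volume_Ioo, sub_neg_eq_add, ← two_mul]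

theorem mainTheorem4 (C₀ C₁ : Set S3) (h₀ : IsCurve C₀) (h₁ : IsCurve C₁)
    (hlink : Linked C₀ C₁) (hcirc : IsCircle C₀) :
    pathModulus 3 (connectingPaths hopf₀ hopf₁) ≤ pathModulus 3 (connectingPaths C₀ C₁) := by
  -- Linked sets in the sense of `Linked` may intersect, because `NullhomotopicIn` includes the
  -- containment; the modulus is then infinite.
  by_cases hdisj : C₁ ⊆ C₀ᶜ
  · exact pathModulus_hopf_le.trans (lower_bound_pathModulus hcirc hdisj hlink.2)
  · obtain ⟨x, hx₁, hx₀⟩ := not_subset.1 hdisj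
    rw [pathModulus_eq_top_of_mem (not_not.1 hx₀) hx₁]
    exact le_top
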